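/- Let $\Pi$ be a finite set of $n$ locations, let $D=(\hat I,O_D,T_D)$ be a strong-sampling asynchronous failure detector (AFD) over $\Pi$ (its inputs are exactly the crash actions $\hat I=\{crash_i\mid i\in\Pi\}$, $O_D$ is the disjoint union of the sets $O_{D,i}$ of outputs at location $i$, every sequence in $T_D$ is valid, i.e. has no output at $i$ after $crash_i$ and infinitely many outputs at every non-crashed location, and $T_D$ is closed under sampling, constrained reordering, crash extension, extra crashes, and under taking valid subsequences). Let $f<n$ be a natural number, and let $A=(A_i)_{i\in\Pi}$ be a distributed algorithm (each $A_i$ a deterministic I/O automaton, with a single task, all of whose locally controlled actions are permanently disabled by $crash_i$) that solves $f$-crash-tolerant binary consensus using $D$ in the environment $\mathcal E_C$: for every fair trace $t$ of the composition of $A$, the reliable FIFO channels $C_{i,j}$ ($i\ne j$), a crash automaton that can generate every sequence of crashes, and $\mathcal E_C$, if the projection of $t$ on $\hat I\cup O_D$ is in $T_D$, then its projection on the propose, crash and decide actions satisfies the specification of $f$-crash-tolerant binary consensus (if the environment is well-formed and at most $f$ locations crash, then crash validity, agreement, validity and termination hold). Here $\mathcal E_C$ is the composition of automata $\mathcal E_{C,i}$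 that may output one of $propose(0)_i$, $propose(1)_i$ (each its own task) once, and none after $crash_i$. Let $\mathcal S$ be the composition of $A$, the channels and $\mathcal E_C$. An observation is a directed acyclic, transitively closed graph $G=(V,Z)$ whose vertices are triples $(i,k,e)$ with $i\in\Pi$, $k\ge 1$, $e\in O_{D,i}$, such that: for each $(i,k)$ there is at most one vertex, and if there is one for $(i,k)$ then there is one for $(i,k')$ for all $1\le k'<k$; there is an edge from the vertex at $(i,k)$ to the vertex at $(i,k+1)$ whenever both exist; and if $j$ is live in $G$ (that is, $V$ contains infinitely many vertices at $j$), every vertex at a location $i\neq j$ has an edge to some vertex at $j$. $live(G)$ is the set of live locations. $G$ is viable for $D$ if for some $t\in T_D$ the projection of $t$ on $O_D$ is the sequence of actions of a topological ordering of $V$. The tree $\mathcal R^G$ has a root $\top$ with vertex tag $\bot$ and configuration tag the initial state of $\mathcal S$; nodes at depth $|V|$ are leaves. Say that $w\in V$ may follow the vertex tag $v$ if $v=\bot$ or $(v,w)\in Z$. A non-leaf node $N$ with vertex tag $v_N$ and configuration tag $c_N$ has the following outgoing edges. (a) For every task $l$ of $\mathcal S$, one edge with label $l$ and vertex tag $v_N$.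 Its action tag is the action of $l$ enabled in $c_N$ if there is one and, in case $l$ is a task of $A_i$ or $\mathcal E_{C,i}$, some vertex at $i$ may follow $v_N$; otherwise its action tag is $\bot$. (b) For every location $i$ and every vertex $w=(i,k,e)$ that may follow $v_N$, one edge with label $FD_i$, vertex tag $w$ and action tag $e$; if no vertex at $i$ may follow $v_N$, a single edge with label $FD_i$, vertex tag $v_N$ and action tag $\bot$. The lower endpoint of an edge has the vertex tag of the edge, and its configuration tag is obtained from $c_N$ by performing the action tag (it is $c_N$ if the action tag is $\bot$). The non-$\bot$ action tags on the path from $\top$ to $N$ form, with the configuration tags, an execution $exe(N)$ of $\mathcal S$; $v\in\{0,1\}$ is a decision value of $exe(N)$ if some $decide(v)_i$ occurs in it. A node is bivalent if it has a descendant with decision value $0$ and a descendant with decision value $1$; it is $v$-valent if it has a descendant with decision value $v$ and none with decision value $1-v$. A decision gadget is either a fork $(N,l,E^l,E'^l)$, where $E^l,E'^l$ are outgoing edges of the node $N$ with label $l$, $N$ is bivalent, and for some $v\in\{0,1\}$ the lower endpoint of $E^l$ is $v$-valent and that of $E'^l$ is $(1-v)$-valent; or a hook $(N,l,r,E^l,E^r,E^{rl})$,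 where $l\neq r$, $E^l$ and $E^r$ are outgoing edges of $N$ with labels $l$ and $r$, $E^{rl}$ is an edge with label $l$ leaving the lower endpoint of $E^r$, $N$ is bivalent, for some $v\in\{0,1\}$ the lower endpoint of $E^l$ is $v$-valent and that of $E^{rl}$ is $(1-v)$-valent, and the action tag of $E^r$ is not $\bot$. It is a non-$\bot$ decision gadget if no edge on the path from $\top$ to $N$ has action tag $\bot$. Theorem. For every observation $G$ that is viable for $D$ and such that $live(G)$ contains at least $n-f$ locations, the tree $\mathcal R^G$ contains at least one non-$\bot$ decision gadget. -/

import Mathlib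

open Stream' (Seq)

/-! ### Finite and infinite sequences

A finite or infinite sequence over `α` is an element of `Stream'.Seq α`; positions start at `0`. -/

namespace AFD

section Sequences

variable {α β : Type}

/-- The sequence, in order, of the defined values of the partial sequence `g`:
its `k`-th entry is `g n`, where `n` is the `k`-th position at which `g` is defined. -/
noncomputable def compress (g : ℕ → Option β) : Seq β := by
  classical
  exact
  ⟨fun k =>
    if ∀ hf : {n | (g n).isSome = true}.Finite, k < hf.toFinset.card then
      g (Nat.nth (fun n => (g n).isSome = true) k)
    else none, by
    intro k hk
    have hnot : ¬ ∀ hf : {n | (g n).isSome = true}.Finite, k < hf.toFinset.card := by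
      intro h
      simp only [if_pos h] at hk
      have := Nat.nth_mem (p := fun n => (g n).isSome = true) k h
      rw [hk] at this
      simp at this
    have hnot' : ¬ ∀ hf : {n | (g n).isSome = true}.Finite, k + 1 < hf.toFinset.card :=
      fun h => hnot fun hf => Nat.lt_of_succ_lt (h hf)
    simp only [if_neg hnot']⟩

/-- The event `a` occurs in `t`. -/
def Occurs (a : α) (t : Seq α) : Prop := ∃ n, t.get? n = some a

/-- Every entry of `t` lies in `B`. -/
def Over (B : Set α) (t : Seq α) : Prop := ∀ n a, t.get? n = some a → a ∈ B

/-- The sequence `t` is finite, of length `n`. -/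
def HasLength (t : Seq α) (n : ℕ) : Prop := ∀ m, (t.get? m).isSome = true ↔ m < n

/-- The sequence `t` is infinite. -/
def IsInfinite (t : Seq α) : Prop := ∀ m, (t.get? m).isSome = true

open Classical in
/-- The projection `t|_B`: the subsequence of all events of `t` that belong to `B`. -/
noncomputable def proj (B : Set α) (t : Seq α) : Seq α :=
  compress fun n => (t.get? n).bind fun a => if a ∈ B then some a else none

/-- `t'` is a prefix of `t`. -/
def IsPrefixOf (t' t : Seq α) : Prop := ∀ n a, t'.get? n = some a → t.get? n = some a

/-- `φ` exhibits `t'` as a subsequence of `t`: the `n`-th event of `t'` is the `φ n`-th event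
of `t`.  (The values of `φ` at positions beyond the end of `t'` are irrelevant.) -/
def IsSubseqVia (φ : ℕ → ℕ) (t' t : Seq α) : Prop :=
  StrictMono φ ∧ ∀ n a, t'.get? n = some a → t.get? (φ n) = some a

end Sequences

/-! ### I/O automata -/

/-- An I/O automaton whose external actions are taken from the set of names `α`.  Internal actions
are private to the automaton: they form a type `Int` of its own, so the actions of the automaton
are `Sum.inl a` with `a` in `inp ∪ out`, and `Sum.inr h` with `h : Int`.  The locally
controlled actions are partitioned into the classes `task T`. -/
structure Automaton (α : Type) where
  State : Type
  Int : Type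
  inp : Set α
  out : Set α
  inp_out_disjoint : Disjoint inp out
  initial : Set State
  initial_nonempty : initial.Nonempty
  trans : State → α ⊕ Int → State → Prop
  trans_ext : ∀ s a s', trans s (Sum.inl a) s' → a ∈ inp ∪ out
  input_enabled : ∀ a ∈ inp, ∀ s, ∃ s', trans s (Sum.inl a) s'
  Task : Type
  task : Task → Set (α ⊕ Int)
  task_cover : ∀ x : α ⊕ Int, (∃ T, x ∈ task T) ↔ ((∃ a ∈ out, x = Sum.inl a) ∨ ∃ h, x = Sum.inr h)
  task_unique : ∀ x T T', x ∈ task T → x ∈ task T' → T = T'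

namespace Automaton

variable {α : Type} (A : Automaton α)

/-- Names of actions: external names and the automaton's own internal actions. -/
abbrev Action : Type := α ⊕ A.Int

/-- The external actions. -/
def ext : Set α := A.inp ∪ A.out

/-- The locally controlled actions: outputs and internal actions. -/
def IsLocal (x : A.Action) : Prop := (∃ a ∈ A.out, x = Sum.inl a) ∨ ∃ h, x = Sum.inr h

/-- The action `x` is enabled in state `s`. -/
def Enabled (s : A.State) (x : A.Action) : Prop := ∃ s', A.trans s x s'

/-- The task `T` is enabled in state `s`. -/
def TaskEnabled (s : A.State) (T : A.Task) : Prop := ∃ x ∈ A.task T, A.Enabled s x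

/-- Task determinism: at most one action of each task is enabled in each state, and
every action is deterministic. -/
def TaskDeterministic : Prop :=
  (∀ s T, ∀ x ∈ A.task T, ∀ y ∈ A.task T, A.Enabled s x → A.Enabled s y → x = y) ∧
  (∀ s x s₁ s₂, A.trans s x s₁ → A.trans s x s₂ → s₁ = s₂)

/-- Deterministic automata: task deterministic, exactly one task, a unique initial state. -/
def Deterministic : Prop :=
  A.TaskDeterministic ∧ (∃! _T : A.Task, True) ∧ ∃! s, s ∈ A.initial

/-- Some step leads from `s` to `s'`. -/
def Step (s s' : A.State) : Prop := ∃ x, A.trans s x s'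

/-- The state `s` is the last state of a finite execution. -/
def Reachable (s : A.State) : Prop := ∃ s₀ ∈ A.initial, Relation.ReflTransGen A.Step s₀ s

/-- When the action `a` occurs in an execution, it permanently disables all locally controlled
actions. -/
def PermanentlyDisabledBy (a : α) : Prop :=
  ∀ s s' s'', A.Reachable s → A.trans s (Sum.inl a) s' → Relation.ReflTransGen A.Step s' s'' →
    ∀ x, A.IsLocal x → ¬ A.Enabled s'' x

/-- A (finite or infinite) execution `st 0, ev 0, st 1, ev 1, …`.
If it has `k` events then its states are `st 0, …, st k`, and later values of `st` have no
significance. -/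
structure Execution where
  ev : Seq A.Action
  st : ℕ → A.State
  initial_mem : st 0 ∈ A.initial
  step : ∀ n x, ev.get? n = some x → A.trans (st n) x (st (n + 1))

variable {A}

/-- Fairness of an execution. -/
def Execution.Fair (e : A.Execution) : Prop :=
  ∀ T : A.Task,
    (∀ k, HasLength e.ev k → ¬ A.TaskEnabled (e.st k) T) ∧
    (IsInfinite e.ev →
      (∀ k, ∃ n ≥ k, ∃ x ∈ A.task T, e.ev.get? n = some x) ∨
      (∀ k, ∃ n ≥ k, ¬ A.TaskEnabled (e.st n) T))

/-- The trace of an execution: the subsequence of its external events. -/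
noncomputable def Execution.trace (e : A.Execution) : Seq α :=
  compress fun n => (e.ev.get? n).bind Sum.getLeft?

variable (A)

/-- `t` is the trace of a fair execution. -/
def FairTrace (t : Seq α) : Prop := ∃ e : A.Execution, e.Fair ∧ e.trace = t

/-- The initial state (used for automata that have exactly one). -/
noncomputable def start : A.State := A.initial_nonempty.some

end Automaton

/-- A family of automata can be composed if no two of them share an output action.  (Internal
actions are private by construction.) -/
def Compatible {α κ : Type} (A : κ → Automaton α) : Prop :=
  ∀ k k', k ≠ k' → Disjoint (A k).out (A k').out

/-- Composition: all the actions with the same name are performed together. -/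
def compose {α κ : Type} (A : κ → Automaton α) (hA : Compatible A) : Automaton α where
  State := ∀ k, (A k).State
  Int := Σ k, (A k).Int
  inp := (⋃ k, (A k).inp) \ ⋃ k, (A k).out
  out := ⋃ k, (A k).out
  inp_out_disjoint := Set.disjoint_sdiff_left
  initial := {s | ∀ k, s k ∈ (A k).initial}
  initial_nonempty := ⟨fun k => (A k).initial_nonempty.some,
    fun k => (A k).initial_nonempty.some_mem⟩
  trans s x s' :=
    match x with
    | Sum.inl a => (∃ k, a ∈ (A k).ext) ∧
        ∀ k, (a ∈ (A k).ext → (A k).trans (s k) (Sum.inl a) (s' k)) ∧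
          (a ∉ (A k).ext → s' k = s k)
    | Sum.inr h => (A h.1).trans (s h.1) (Sum.inr h.2) (s' h.1) ∧ ∀ k, k ≠ h.1 → s' k = s k
  trans_ext := by
    rintro s a s' ⟨⟨k, hk⟩, -⟩
    by_cases ho : a ∈ ⋃ k, (A k).out
    · exact Or.inr ho
    · refine Or.inl ⟨?_, ho⟩
      rcases hk with hk | hk
      · exact Set.mem_iUnion.2 ⟨k, hk⟩
      · exact absurd (Set.mem_iUnion.2 ⟨k, hk⟩) ho
  input_enabled := by
    classical
    rintro a ⟨hi, ho⟩ s
    obtain ⟨k₀, hk₀⟩ := Set.mem_iUnion.1 hi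
    have h : ∀ k, ∃ s', (a ∈ (A k).ext → (A k).trans (s k) (Sum.inl a) s') ∧
        (a ∉ (A k).ext → s' = s k) := by
      intro k
      by_cases hk : a ∈ (A k).ext
      · have hin : a ∈ (A k).inp := by
          rcases hk with hk | hk
          · exact hk
          · exact absurd (Set.mem_iUnion.2 ⟨k, hk⟩) ho
        obtain ⟨s', hs'⟩ := (A k).input_enabled a hin (s k)
        exact ⟨s', fun _ => hs', fun hn => absurd hk hn⟩
      · exact ⟨s k, fun hn => absurd hn hk, fun _ => rfl⟩
    choose s' hs' using h
    exact ⟨s', ⟨k₀, Or.inl hk₀⟩, hs'⟩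
  Task := Σ k, (A k).Task
  task T :=
    {x | (∃ a, Sum.inl a ∈ (A T.1).task T.2 ∧ x = Sum.inl a) ∨
      ∃ h, Sum.inr h ∈ (A T.1).task T.2 ∧ x = Sum.inr ⟨T.1, h⟩}
  task_cover := by
    intro x
    constructor
    · rintro ⟨⟨k, T⟩, ⟨a, ha, rfl⟩ | ⟨h, hh, rfl⟩⟩
      · rcases ((A k).task_cover _).1 ⟨T, ha⟩ with ⟨b, hb, hab⟩ | ⟨h, hh⟩
        · cases hab
          exact Or.inl ⟨a, Set.mem_iUnion.2 ⟨k, hb⟩, rfl⟩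
        · cases hh
      · exact Or.inr ⟨_, rfl⟩
    · rintro (⟨a, ha, rfl⟩ | ⟨⟨k, h⟩, rfl⟩)
      · obtain ⟨k, hk⟩ := Set.mem_iUnion.1 ha
        obtain ⟨T, hT⟩ := ((A k).task_cover (Sum.inl a)).2 (Or.inl ⟨a, hk, rfl⟩)
        exact ⟨⟨k, T⟩, Or.inl ⟨a, hT, rfl⟩⟩
      · obtain ⟨T, hT⟩ := ((A k).task_cover (Sum.inr h)).2 (Or.inr ⟨h, rfl⟩)
        exact ⟨⟨k, T⟩, Or.inr ⟨h, hT, rfl⟩⟩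
  task_unique := by
    rintro x ⟨k, T⟩ ⟨k', T'⟩ hx hx'
    rcases hx with ⟨a, ha, rfl⟩ | ⟨h, hh, rfl⟩
    · rcases hx' with ⟨b, hb, hab⟩ | ⟨h, -, hh⟩
      · cases hab
        have o₁ : a ∈ (A k).out := by
          rcases ((A k).task_cover _).1 ⟨T, ha⟩ with ⟨b, hb, hab⟩ | ⟨h, hh⟩
          · cases hab; exact hb
          · cases hh
        have o₂ : a ∈ (A k').out := by
          rcases ((A k').task_cover _).1 ⟨T', hb⟩ with ⟨b, hb, hab⟩ | ⟨h, hh⟩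
          · cases hab; exact hb
          · cases hh
        by_cases hk : k = k'
        · subst hk
          exact congrArg (Sigma.mk k) ((A k).task_unique _ _ _ ha hb)
        · exact absurd o₂ (Set.disjoint_left.1 (hA k k' hk) o₁)
      · cases hh
    · rcases hx' with ⟨b, -, hab⟩ | ⟨h', hh', hab⟩
      · cases hab
      · cases hab
        exact congrArg (Sigma.mk k) ((A k).task_unique _ _ _ hh hh')

/-! ### Problems -/

/-- The data `(I_P, O_P, T_P)` of a problem. -/
structure Problem (α : Type) where
  I : Set α
  O : Set α
  T : Set (Seq α)

/-- The requirements on `(I_P, O_P, T_P)`: inputs and outputs are disjoint, `T_P` consists of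
sequences over `I_P ∪ O_P`, and some automaton solves the problem. -/
def Problem.IsProblem {α : Type} (P : Problem α) : Prop :=
  Disjoint P.I P.O ∧ (∀ t ∈ P.T, Over (P.I ∪ P.O) t) ∧
  ∃ U : Automaton α, U.inp = P.I ∧ U.out = P.O ∧ ∀ t, U.FairTrace t → t ∈ P.T

/-- The external actions, for the set `ι` of locations, the message alphabet `M`, and the
failure-detector outputs `O i` at each location `i`:
`crash i` is `crash_i`, `send m j i` is `send(m,j)_i`, `receive m j i` is `receive(m,j)_i`,
`propose v i` is `propose(v)_i`, `decide v i` is `decide(v)_i` (with `false`, `true` for the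
values `0`, `1`), and `fd i o` is the failure-detector output `o` at `i`. -/
inductive Act (ι M : Type) (O : ι → Type) : Type
  | crash (i : ι)
  | send (m : M) (j i : ι)
  | receive (m : M) (j i : ι)
  | propose (v : Bool) (i : ι)
  | decide (v : Bool) (i : ι)
  | fd (i : ι) (o : O i)

variable {ι M : Type} {O : ι → Type}

/-- The location at which an action occurs. -/
def Act.loc : Act ι M O → ι
  | .crash i => i
  | .send _ _ i => i
  | .receive _ _ i => i
  | .propose _ i => i
  | .decide _ i => i
  | .fd i _ => i

/-- The set of crash actions. -/
def crashActs : Set (Act ι M O) := Set.range Act.crash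

/-- The set of failure-detector outputs. -/
def fdActs : Set (Act ι M O) := {a | ∃ i o, a = Act.fd i o}

/-- The failure-detector outputs at location `i`. -/
def fdActsAt (i : ι) : Set (Act ι M O) := {a | ∃ o, a = Act.fd i o}

/-- The locations at which a crash event occurs in `t`. -/
def faulty (t : Seq (Act ι M O)) : Set ι := {i | Occurs (Act.crash i) t}

/-- The locations at which no crash event occurs in `t`. -/
def liveLocs (t : Seq (Act ι M O)) : Set ι := (faulty t)ᶜ

/-! ### Asynchronous failure detectors -/

/-- Valid sequences: no output at `i` after `crash_i`, and infinitely many outputs at `i` if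
`crash_i` does not occur. -/
def Valid (t : Seq (Act ι M O)) : Prop :=
  (∀ i m n, m < n → t.get? m = some (Act.crash i) → ∀ o, t.get? n ≠ some (Act.fd i o)) ∧
  (∀ i ∈ liveLocs t, ∀ k, ∃ n ≥ k, ∃ o, t.get? n = some (Act.fd i o))

/-- `t'` is a sampling of `t`. -/
def IsSampling (t' t : Seq (Act ι M O)) : Prop :=
  ∃ φ : ℕ → ℕ, IsSubseqVia φ t' t ∧
    ∀ i,
      (i ∈ liveLocs t → proj (fdActsAt i) t' = proj (fdActsAt i) t) ∧
      (i ∈ faulty t →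
        (∃ n, t'.get? n = some (Act.crash i) ∧ ∀ m < φ n, t.get? m ≠ some (Act.crash i)) ∧
        IsPrefixOf (proj (fdActsAt i) t') (proj (fdActsAt i) t))

/-- `t'` is a constrained reordering of `t`: a valid sequence obtained by a bijection `σ` between
the events (positions) of `t` and those of `t'`, which keeps the order of any two outputs
at the same location and of any crash event and any later output. -/
def IsConstrainedReordering (t' t : Seq (Act ι M O)) : Prop :=
  Valid t' ∧ ∃ σ : ℕ → ℕ,
    Set.BijOn σ {n | (t.get? n).isSome = true} {n | (t'.get? n).isSome = true} ∧
    (∀ n, (t.get? n).isSome = true → t'.get? (σ n) = t.get? n) ∧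
    ∀ m n a b, m < n → t.get? m = some a → t.get? n = some b →
      ((a ∈ fdActs ∧ b ∈ fdActs ∧ a.loc = b.loc) ∨ (a ∈ crashActs ∧ b ∈ fdActs)) → σ m < σ n

/-- `t'` is a crash extension of the finite sequence `p`. -/
def IsCrashExtension (t' : Seq (Act ι M O)) (p : List (Act ι M O)) : Prop :=
  ∃ s : Seq (Act ι M O), Over crashActs s ∧ t' = (Seq.ofList p).append s

/-- The event at position `n` of `t` is an extra crash. -/
def IsExtraCrash (t : Seq (Act ι M O)) (n : ℕ) : Prop :=
  ∃ i, t.get? n = some (Act.crash i) ∧ ∃ m < n, t.get? m = some (Act.crash i)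

open Classical in
/-- The minimal-crash sequence of `t`: all extra crashes are deleted. -/
noncomputable def mincrash (t : Seq (Act ι M O)) : Seq (Act ι M O) :=
  compress fun n => if IsExtraCrash t n then none else t.get? n

/-- Asynchronous failure detectors. -/
structure IsAFD (D : Problem (Act ι M O)) : Prop where
  isProblem : D.IsProblem
  crash_exclusive : D.I = crashActs
  outputs : D.O = fdActs
  validity : ∀ t ∈ D.T, Valid t
  sampling : ∀ t ∈ D.T, ∀ t', IsSampling t' t → t' ∈ D.T
  reordering : ∀ t ∈ D.T, ∀ t', IsConstrainedReordering t' t → t' ∈ D.T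
  crash_extension : ∀ t ∈ D.T, ∀ p : List (Act ι M O), IsPrefixOf (Seq.ofList p) t →
    ∀ t', IsCrashExtension t' p →
      ((∃ k, HasLength t' k) → ∃ t'' ∈ D.T, IsPrefixOf t' t'') ∧
      (faulty t' = Set.univ → t' ∈ D.T)
  extra_crashes : ∀ t ∈ D.T, ∀ t', mincrash t = mincrash t' → t' ∈ D.T

/-- Strong-sampling AFDs: every valid subsequence of a sequence in `T_D` is in `T_D`. -/
structure IsStrongSamplingAFD (D : Problem (Act ι M O)) : Prop extends IsAFD D where
  strong_sampling : ∀ t ∈ D.T, ∀ t', (∃ φ, IsSubseqVia φ t' t) → Valid t' → t' ∈ D.T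

/-! ### The components of a system -/

/-- Process automata at location `i`.  (That internal actions of the automaton occur at `i` is a
convention on their location.) -/
structure IsProcAutomaton (i : ι) (A : Automaton (Act ι M O)) : Prop where
  crash_mem : Act.crash i ∈ A.inp
  send_mem : ∀ m j, j ≠ i → Act.send m j i ∈ A.out
  receive_mem : ∀ m j, j ≠ i → Act.receive m j i ∈ A.inp
  loc_eq : ∀ a ∈ A.ext, a.loc = i
  deterministic : A.Deterministic
  crash_disables : A.PermanentlyDisabledBy (Act.crash i)

/-- The steps of the channel from `i` to `j`; the state is the queue of messages in transit. -/
inductive ChanStep (i j : ι) : List M → Act ι M O ⊕ Empty → List M → Prop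
  | send (q : List M) (m : M) : ChanStep i j q (Sum.inl (Act.send m j i)) (q ++ [m])
  | receive (q : List M) (m : M) : ChanStep i j (m :: q) (Sum.inl (Act.receive m i j)) q

/-- The reliable FIFO channel from `i` to `j`. -/
def channel (i j : ι) : Automaton (Act ι M O) where
  State := List M
  Int := Empty
  inp := {a | ∃ m, a = Act.send m j i}
  out := {a | ∃ m, a = Act.receive m i j}
  inp_out_disjoint := by
    rw [Set.disjoint_left]
    rintro _ ⟨m, rfl⟩ ⟨m', h⟩
    cases h
  initial := {[]}
  initial_nonempty := ⟨[], rfl⟩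
  trans := ChanStep i j
  trans_ext := by
    intro s a s' h
    cases h with
    | send q m => exact Or.inl ⟨m, rfl⟩
    | receive q m => exact Or.inr ⟨m, rfl⟩
  input_enabled := by
    rintro _ ⟨m, rfl⟩ s
    exact ⟨_, ChanStep.send s m⟩
  Task := Unit
  task _ := {x | ∃ m, x = Sum.inl (Act.receive m i j)}
  task_cover := by
    rintro (a | h)
    · simp
    · exact h.elim
  task_unique := fun _ _ _ _ _ => rfl

/-- Crash automata: the outputs are the crash actions, there are no inputs, and every sequence
of crash actions is a fair trace. -/
structure IsCrashAutomaton (C : Automaton (Act ι M O)) : Prop where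
  inp_eq : C.inp = ∅
  out_eq : C.out = crashActs
  fairTrace : ∀ t, Over crashActs t → C.FairTrace t

/-- The steps of the consensus environment at `i`; the state is the variable `stop`. -/
inductive EnvStep (i : ι) : Bool → Act ι M O ⊕ Empty → Bool → Prop
  | crash (b : Bool) : EnvStep i b (Sum.inl (Act.crash i)) true
  | decide (b v : Bool) : EnvStep i b (Sum.inl (Act.decide v i)) b
  | propose (v : Bool) : EnvStep i false (Sum.inl (Act.propose v i)) true

/-- The consensus environment at location `i`: it proposes at most one value, unless `crash_i`
occurs first.  Each of the actions `propose(0)_i`, `propose(1)_i` is a task. -/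
def consensusEnv (i : ι) : Automaton (Act ι M O) where
  State := Bool
  Int := Empty
  inp := {a | a = Act.crash i ∨ ∃ v, a = Act.decide v i}
  out := {a | ∃ v, a = Act.propose v i}
  inp_out_disjoint := by
    rw [Set.disjoint_left]
    rintro _ (rfl | ⟨v, rfl⟩) ⟨v', h⟩ <;> cases h
  initial := {false}
  initial_nonempty := ⟨false, rfl⟩
  trans := EnvStep i
  trans_ext := by
    intro s a s' h
    cases h with
    | crash b => exact Or.inl (Or.inl rfl)
    | decide b v => exact Or.inl (Or.inr ⟨_, rfl⟩)
    | propose v => exact Or.inr ⟨_, rfl⟩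
  input_enabled := by
    rintro _ (rfl | ⟨v, rfl⟩) s
    · exact ⟨_, EnvStep.crash s⟩
    · exact ⟨_, EnvStep.decide s v⟩
  Task := Bool
  task v := {Sum.inl (Act.propose v i)}
  task_cover := by
    rintro (a | h)
    · simp
    · exact h.elim
  task_unique := by
    rintro x v v' h h'
    have h₁ : x = Sum.inl (Act.propose v i) := h
    have h₂ : x = Sum.inl (Act.propose v' i) := h'
    rw [h₁] at h₂
    cases h₂
    rfl

/-- The component automata of a system, apart from the crash automaton. -/
inductive Comp (ι : Type) : Type
  | proc (i : ι)
  | chan (i j : ι) (h : i ≠ j)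
  | env (i : ι)

/-- The components of the system made of the distributed algorithm `A`, the channels, and the
environment with parts `E i`. -/
def sysFamily (A E : ι → Automaton (Act ι M O)) : Comp ι → Automaton (Act ι M O)
  | .proc i => A i
  | .chan i j _ => channel i j
  | .env i => E i

/-- The same components together with the crash automaton `C`. -/
def fullFamily (A E : ι → Automaton (Act ι M O)) (C : Automaton (Act ι M O)) :
    Option (Comp ι) → Automaton (Act ι M O)
  | none => C
  | some k => sysFamily A E k

theorem Compatible.sys {A E : ι → Automaton (Act ι M O)} {C : Automaton (Act ι M O)}
    (h : Compatible (fullFamily A E C)) : Compatible (sysFamily A E) :=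
  fun k k' hk => h (some k) (some k') (fun he => hk (Option.some.inj he))

/-- The distributed algorithm `A` solves the crash problem `P` using the crash problem `Q` in
the environment with parts `E i`, crashes being generated by the crash automaton `C`. -/
structure SolvesUsing (A : ι → Automaton (Act ι M O)) (P Q : Problem (Act ι M O))
    (E : ι → Automaton (Act ι M O)) (C : Automaton (Act ι M O)) : Prop where
  inp_eq : ∀ i, (A i).inp =
    {a | ∃ j, j ≠ i ∧ a ∈ (channel j i : Automaton (Act ι M O)).out} ∪
      {a ∈ P.I | a.loc = i} ∪ {a ∈ Q.O | a.loc = i}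
  out_eq : ∀ i, (A i).out =
    ({a | ∃ j, j ≠ i ∧ a ∈ (channel i j : Automaton (Act ι M O)).inp} ∪
      {a ∈ P.O | a.loc = i} ∪ {a ∈ Q.I | a.loc = i}) \ {Act.crash i}
  compatible : Compatible (fullFamily A E C)
  traces : ∀ t, (compose (fullFamily A E C) compatible).FairTrace t →
    proj (Q.I ∪ Q.O) t ∈ Q.T → proj (P.I ∪ P.O) t ∈ P.T

/-! ### Crash-tolerant binary consensus -/

/-- Environment well-formedness. -/
def EnvWellFormed (t : Seq (Act ι M O)) : Prop :=
  (∀ i m n v w, t.get? m = some (Act.propose v i) → t.get? n = some (Act.propose w i) → m = n) ∧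
  (∀ i m n v, m < n → t.get? m = some (Act.crash i) → t.get? n ≠ some (Act.propose v i)) ∧
  (∀ i ∈ liveLocs t, ∃ v, Occurs (Act.propose v i) t)

/-- At most `f` locations crash. -/
def CrashLimited (f : ℕ) (t : Seq (Act ι M O)) : Prop := (faulty t).encard ≤ f

/-- No location decides after crashing. -/
def CrashValidity (t : Seq (Act ι M O)) : Prop :=
  ∀ i m n v, m < n → t.get? m = some (Act.crash i) → t.get? n ≠ some (Act.decide v i)

/-- No two locations decide differently. -/
def Agreement (t : Seq (Act ι M O)) : Prop :=
  ∀ i j v w, Occurs (Act.decide v i) t → Occurs (Act.decide w j) t → v = w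

/-- Every decision value is proposed somewhere. -/
def ConsensusValidity (t : Seq (Act ι M O)) : Prop :=
  ∀ i v, Occurs (Act.decide v i) t → ∃ j, Occurs (Act.propose v j) t

/-- Each location decides at most once, and each live location exactly once. -/
def Termination (t : Seq (Act ι M O)) : Prop :=
  (∀ i m n v w, t.get? m = some (Act.decide v i) → t.get? n = some (Act.decide w i) → m = n) ∧
  (∀ i ∈ liveLocs t, ∃ v, Occurs (Act.decide v i) t)

/-- The `f`-crash-tolerant binary consensus problem. -/
def consensus (f : ℕ) : Problem (Act ι M O) where
  I := {a | (∃ v i, a = Act.propose v i) ∨ a ∈ crashActs}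
  O := {a | ∃ v i, a = Act.decide v i}
  T := {t | Over {a | (∃ v i, a = Act.propose v i) ∨ a ∈ crashActs ∨ ∃ v i, a = Act.decide v i} t ∧
    (EnvWellFormed t → CrashLimited f t →
      CrashValidity t ∧ Agreement t ∧ ConsensusValidity t ∧ Termination t)}

/-! ### Observations -/

/-- A vertex `(i, k, e)`: the output `e` is the `k`-th one at location `i`. -/
structure Vertex (ι : Type) (O : ι → Type) where
  loc : ι
  idx : ℕ
  out : O loc

/-- The action of a vertex. -/
def Vertex.act (v : Vertex ι O) : Act ι M O := Act.fd v.loc v.out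

/-- Observations: transitively closed directed acyclic graphs of failure-detector outputs. -/
structure Observation (ι : Type) (O : ι → Type) where
  V : Set (Vertex ι O)
  Z : Vertex ι O → Vertex ι O → Prop
  edge_mem : ∀ u v, Z u v → u ∈ V ∧ v ∈ V
  idx_pos : ∀ v ∈ V, 0 < v.idx
  acyclic : ∀ v, ¬ Relation.TransGen Z v v
  idx_unique : ∀ u ∈ V, ∀ v ∈ V, u.loc = v.loc → u.idx = v.idx → u = v
  idx_down : ∀ v ∈ V, ∀ k, 0 < k → k < v.idx → ∃ u ∈ V, u.loc = v.loc ∧ u.idx = k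
  edge_succ : ∀ u ∈ V, ∀ v ∈ V, u.loc = v.loc → v.idx = u.idx + 1 → Z u v
  edge_live : ∀ i j, i ≠ j → {v ∈ V | v.loc = j}.Infinite →
    ∀ v₁ ∈ V, v₁.loc = i → ∃ v₂ ∈ V, v₂.loc = j ∧ Z v₁ v₂
  edge_trans : ∀ u v w, Z u v → Z v w → Z u w

namespace Observation

variable (G : Observation ι O)

/-- The locations with infinitely many vertices. -/
def live : Set ι := {i | {v ∈ G.V | v.loc = i}.Infinite}

/-- `s` is a topological ordering of the vertices: it lists every vertex exactly once, and
edges go forward. -/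
def IsTopologicalOrdering (s : Seq (Vertex ι O)) : Prop :=
  Over G.V s ∧ (∀ v ∈ G.V, ∃! n, s.get? n = some v) ∧
  ∀ m n u v, s.get? m = some u → s.get? n = some v → G.Z u v → m < n

/-- The projection of `t` on the failure-detector outputs is the event sequence of some
topological ordering of the vertices. -/
def IsCompatibleWith (t : Seq (Act ι M O)) : Prop :=
  ∃ s : Seq (Vertex ι O), G.IsTopologicalOrdering s ∧ proj fdActs t = s.map Vertex.act

/-- `G` is viable for `D`. -/
def Viable (D : Problem (Act ι M O)) : Prop := ∃ t ∈ D.T, G.IsCompatibleWith t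

/-- Vertex `w` may follow the vertex tag `v`, where `none` is the null vertex `(⊥, 0, ⊥)`:
any vertex may follow the null vertex, otherwise there must be an edge from `v` to `w`. -/
def Follows : Option (Vertex ι O) → Vertex ι O → Prop
  | none, w => w ∈ G.V
  | some u, w => G.Z u w

/-- Some vertex at location `i` may follow the vertex tag `v`. -/
def FollowsAt (v : Option (Vertex ι O)) (i : ι) : Prop := ∃ w, G.Follows v w ∧ w.loc = i

end Observation

/-! ### The execution tree of an observation

In what follows the system `S` is the composition of the family `sysFamily A E`. -/

section Tree

variable (A E : ι → Automaton (Act ι M O)) (hS : Compatible (sysFamily A E))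

/-- The system: distributed algorithm, channels, and environment. -/
abbrev sys : Automaton (Act ι M O) := compose (sysFamily A E) hS

/-- Edge labels: the tasks of the system and the labels `FD_i`.  Task `⟨k, T⟩` is the task `T` of
the component `k`. -/
inductive Label : Type
  | task (k : Comp ι) (T : (sysFamily A E k).Task)
  | FD (i : ι)

/-- An edge of the tree as seen from its upper endpoint: its label, its vertex tag (also the vertex
tag of its lower endpoint), its action tag (`none` is `⊥`), and the configuration tag of
its lower endpoint. -/
structure Edge where
  label : Label A E
  vtag : Option (Vertex ι O)
  act : Option (sys A E hS).Action
  cfg : (sys A E hS).State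

/-- A node of the tree is given by the path from the root `⊤` to it, that is, by the
list of the edges on that path, the last edge coming first. The root is `[]`, and the
lower endpoint of an edge `e` whose upper endpoint is `N` is `e :: N`. -/
abbrev Node : Type := List (Edge A E hS)

variable {A E hS}

/-- The vertex tag of a node. -/
def Node.vtag : Node A E hS → Option (Vertex ι O)
  | [] => none
  | e :: _ => e.vtag

/-- The configuration tag of a node. -/
noncomputable def Node.cfg : Node A E hS → (sys A E hS).State
  | [] => (sys A E hS).start
  | e :: _ => e.cfg

variable (G : Observation ι O)

/-- The vertex tags `v'` of the edges with a given label leaving a node with vertex tag `v`. -/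
def IsVertexTag (v : Option (Vertex ι O)) : Label A E → Option (Vertex ι O) → Prop
  | .task _ _, v' => v' = v
  | .FD i, v' => (∃ w, G.Follows v w ∧ w.loc = i ∧ v' = some w) ∨ (¬ G.FollowsAt v i ∧ v' = v)

/-- The condition on the vertex tag `v` for a task of component `k` to take a step. -/
def MayAct (v : Option (Vertex ι O)) : Comp ι → Prop
  | .proc i => G.FollowsAt v i
  | .env i => G.FollowsAt v i
  | .chan _ _ _ => True

/-- `x` is the action tag of an edge with the given label and vertex tag `v'` that leaves a
node with configuration tag `c` and vertex tag `v`. -/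
def IsActionTag (c : (sys A E hS).State) (v : Option (Vertex ι O)) :
    Label A E → Option (Vertex ι O) → Option (sys A E hS).Action → Prop
  | .task k T, _, x =>
      (MayAct G v k ∧
        ∃ a, a ∈ (sys A E hS).task ⟨k, T⟩ ∧ (sys A E hS).Enabled c a ∧ x = some a) ∨
      (¬ (MayAct G v k ∧ (sys A E hS).TaskEnabled c ⟨k, T⟩) ∧ x = none)
  | .FD _, v', x =>
      (∃ w : Vertex ι O, v' = some w ∧ v' ≠ v ∧ x = some (Sum.inl w.act)) ∨ (v' = v ∧ x = none)

/-- `c'` results from `c` by performing the action `x`, or equals `c` if `x` is `⊥`. -/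
def IsNextCfg (c : (sys A E hS).State) :
    Option (sys A E hS).Action → (sys A E hS).State → Prop
  | none, c' => c' = c
  | some a, c' => (sys A E hS).trans c a c'

/-- `e` is an outgoing edge of the node `N` in the tree of `G`; nodes at depth `|V|` are leaves. -/
def IsEdgeOf (N : Node A E hS) (e : Edge A E hS) : Prop :=
  (N.length : ℕ∞) < G.V.encard ∧
  IsVertexTag G N.vtag e.label e.vtag ∧
  IsActionTag G N.cfg N.vtag e.label e.vtag e.act ∧
  IsNextCfg N.cfg e.act e.cfg

/-- `N` is a node of the tree of `G`. -/
inductive IsNode : Node A E hS → Prop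
  | root : IsNode []
  | child (N : Node A E hS) (e : Edge A E hS) : IsNode N → IsEdgeOf G N e → IsNode (e :: N)

/-- The events of the execution `exe(N)`, each with the state it leads to: the edges on the path
to `N` with action tag `⊥` are skipped. -/
def exe (N : Node A E hS) : List ((sys A E hS).Action × (sys A E hS).State) :=
  N.reverse.filterMap fun e => e.act.map fun a => (a, e.cfg)

/-- `v` is a decision value of `exe(N)`. -/
def HasDecisionValue (N : Node A E hS) (v : Bool) : Prop :=
  ∃ i c, (Sum.inl (Act.decide v i), c) ∈ exe N

/-- `N'` is a descendant of `N` in the tree of `G` (possibly `N` itself). -/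
def IsDescendant (N N' : Node A E hS) : Prop := IsNode G N' ∧ N <:+ N'

/-- Bivalent nodes. -/
def Bivalent (N : Node A E hS) : Prop :=
  (∃ N₀, IsDescendant G N N₀ ∧ HasDecisionValue N₀ false) ∧
  (∃ N₁, IsDescendant G N N₁ ∧ HasDecisionValue N₁ true)

/-- `v`-valent nodes. -/
def Valent (v : Bool) (N : Node A E hS) : Prop :=
  (∃ N', IsDescendant G N N' ∧ HasDecisionValue N' v) ∧
  ∀ N', IsDescendant G N N' → ¬ HasDecisionValue N' (!v)

/-- A node is non-`⊥` if no edge on the path from the root to it has action tag `⊥`. -/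
def NonBotNode (N : Node A E hS) : Prop := ∀ e ∈ N, e.act ≠ none

variable (A E hS) in
/-- The tuples `(N, l, Eˡ, E'ˡ)` and `(N, l, r, Eˡ, Eʳ, Eʳˡ)`. -/
inductive GadgetTuple : Type
  | four (N : Node A E hS) (l : Label A E) (El El' : Edge A E hS)
  | six (N : Node A E hS) (l r : Label A E) (El Er Erl : Edge A E hS)

/-- The tuple is a gadget in the tree of `G`. -/
def IsGadget : GadgetTuple A E hS → Prop
  | .four N l El El' =>
      IsNode G N ∧ (IsEdgeOf G N El ∧ El.label = l) ∧ (IsEdgeOf G N El' ∧ El'.label = l)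
  | .six N l r El Er Erl =>
      IsNode G N ∧ l ≠ r ∧ (IsEdgeOf G N El ∧ El.label = l) ∧ (IsEdgeOf G N Er ∧ Er.label = r) ∧
      (IsEdgeOf G (Er :: N) Erl ∧ Erl.label = l)

/-- Forks in the tree of `G`. -/
def IsFork (Y : GadgetTuple A E hS) : Prop :=
  IsGadget G Y ∧
  match Y with
  | .four N _ El El' => Bivalent G N ∧ ∃ v, Valent G v (El :: N) ∧ Valent G (!v) (El' :: N)
  | .six .. => False

/-- Hooks in the tree of `G`. -/
def IsHook (Y : GadgetTuple A E hS) : Prop :=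
  IsGadget G Y ∧
  match Y with
  | .four .. => False
  | .six N _ _ El Er Erl =>
      Bivalent G N ∧ (∃ v, Valent G v (El :: N) ∧ Valent G (!v) (Erl :: Er :: N)) ∧ Er.act ≠ none

/-- Decision gadgets: forks and hooks. -/
def IsDecisionGadget (Y : GadgetTuple A E hS) : Prop := IsFork G Y ∨ IsHook G Y

/-- The first element of the tuple. -/
def GadgetTuple.node : GadgetTuple A E hS → Node A E hS
  | .four N .. => N
  | .six N .. => N

/-- Non-`⊥` gadgets: the first element of the tuple is a non-`⊥` node. -/
def NonBotGadget (Y : GadgetTuple A E hS) : Prop := NonBotNode Y.node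

end Tree

end AFD

namespace AFD

/-! ### Compressing partial sequences -/

section Compress

variable {α β : Type}

/-! The proof is a bivalence argument inside the tree. The tree is tied to the algorithm by
`IsFairBranch.consensus`: along a branch on which every label recurs forever, some location decides,
all decisions agree, and every decided value has been proposed.

The tree contains no crashes, whereas the hypothesis on `A` concerns fair traces of the system with
the crash automaton, so crashes must be put back. Viability supplies `t ∈ D.T` whose outputs list
the vertices in a topological order. Before the edges with vertex tag `w` one inserts the crashes
that precede `w` in `t` (`IsFairBranch.exists_interleaving`). Once `crash_i` has been inserted, no
vertex at `i` may follow the current tag, because `t` has no output at `i` after the crash; hence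
the process and the environment at `i` perform no further step of their own in the tree either.
Their states may drift away from the configuration tags, since they still receive inputs, but they
are permanently disabled, and all other components agree with the tree. This gives a fair run of the
full system (`IsFairBranch.exists_stutterRun`). Its crashes and detector outputs form a valid
subsequence of `t`. A branch may skip outputs at live locations, so this need not be a sampling; it
is strong sampling that puts it in `D.T`. The locations that never crash are exactly those in
`G.live`, so at most `f` crash.

Every node lies on a fair branch (`IsNode.exists_chain`, `IsChain.exists_branch`). Hence a node
carries at most one decision value and has a deciding descendant, and a node that is not bivalent is
`v`-valent for some `v`. The root is bivalent: let everyone who may act propose `v`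
(`exists_node_proposing`); nothing else can be proposed afterwards, so `v` is decided. If below
every bivalent node each label had an edge into a bivalent node, there would be a fair branch
through infinitely many bivalent nodes, on which no decision could occur. So for some bivalent `N`
and some label `l` no edge labelled `l` below `N` leads to a bivalent node, and
`exists_decisionGadget` finds a fork or a hook on a path from `N`. Finally, edges with action tag
`⊥` change neither tags nor decisions, so they can be cut out of the path to the gadget
(`exists_nonBotGadget`). -/

theorem compress_get?_eq_some {g : ℕ → Option β} {k : ℕ} {b : β} :
    (compress g).get? k = some b ↔
      ∃ n, g n = some b ∧ Nat.count (fun n => (g n).isSome = true) n = k := by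
  classical
  have hdef : (compress g).get? k =
      if ∀ hf : {n | (g n).isSome = true}.Finite, k < hf.toFinset.card then
        g (Nat.nth (fun n => (g n).isSome = true) k) else none := rfl
  rw [hdef]
  constructor
  · intro h
    split_ifs at h with hc
    exact ⟨_, h, Nat.count_nth hc⟩
  · rintro ⟨n, hn, rfl⟩
    have hp : (g n).isSome = true := by simp [hn]
    rw [if_pos, Nat.nth_count (p := fun n => (g n).isSome = true) hp, hn]
    intro hf
    exact Nat.count_lt_card (p := fun n => (g n).isSome = true) hf hp

theorem compress_get?_count {g : ℕ → Option β} {n : ℕ} {b : β} (h : g n = some b) :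
    (compress g).get? (Nat.count (fun n => (g n).isSome = true) n) = some b :=
  compress_get?_eq_some.2 ⟨n, h, rfl⟩

theorem occurs_compress {g : ℕ → Option β} {b : β} :
    Occurs b (compress g) ↔ ∃ n, g n = some b := by
  constructor
  · rintro ⟨k, hk⟩
    obtain ⟨n, hn, -⟩ := compress_get?_eq_some.1 hk
    exact ⟨n, hn⟩
  · rintro ⟨n, hn⟩
    exact ⟨_, compress_get?_count hn⟩

theorem seq_ext_some {s t : Seq β} (h : ∀ k b, s.get? k = some b ↔ t.get? k = some b) :
    s = t := by
  apply Stream'.Seq.ext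
  intro k
  exact Option.ext fun b => h k b

/-- The index of position `n` in `compress g` is the number of defined entries before `n`; positions
where `g` is undefined move neither counter. -/
theorem count_compress {γ : Type} (g : ℕ → Option β) (f : β → Option γ) (n : ℕ) :
    Nat.count (fun k => (((compress g).get? k).bind f).isSome = true)
      (Nat.count (fun n => (g n).isSome = true) n) =
    Nat.count (fun n => ((g n).bind f).isSome = true) n := by
  induction n with
  | zero => simp
  | succ n ih =>
    rw [Nat.count_succ (fun n => ((g n).bind f).isSome = true), ← ih,
      Nat.count_succ (fun n => (g n).isSome = true)]
    rcases hg : g n with _ | b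
    · simp
    · simp [Nat.count_succ, compress_get?_count hg]

/-- Allows traces and projections to be read off an uncompressed run; `count_compress` aligns the
indices. -/
theorem compress_bind_compress {γ : Type} (g : ℕ → Option β) (f : β → Option γ) :
    compress (fun k => ((compress g).get? k).bind f) = compress fun n => (g n).bind f := by
  apply seq_ext_some
  intro j c
  rw [compress_get?_eq_some, compress_get?_eq_some]
  constructor
  · rintro ⟨k, hk, rfl⟩
    obtain ⟨b, hb, hc⟩ := Option.bind_eq_some_iff.1 hk
    obtain ⟨n, hn, rfl⟩ := compress_get?_eq_some.1 hb
    exact ⟨n, by simp [hn, hc], (count_compress g f n).symm⟩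
  · rintro ⟨n, hn, rfl⟩
    obtain ⟨b, hb, hc⟩ := Option.bind_eq_some_iff.1 hn
    exact ⟨_, by simp [compress_get?_count hb, hc], count_compress g f n⟩

theorem count_lt_count_iff {p : ℕ → Prop} [DecidablePred p] {m n : ℕ} (hm : p m) :
    Nat.count p m < Nat.count p n ↔ m < n := by
  constructor
  · intro h
    by_contra hn
    exact absurd (Nat.count_monotone p (not_lt.1 hn)) (not_le.2 h)
  · exact fun h => Nat.count_strict_mono hm h

/-- A partial sequence whose entries are found at increasing positions of `t` compresses to a
subsequence of `t`. -/
theorem isSubseqVia_compress {g : ℕ → Option β} {t : Seq β} {ψ : ℕ → ℕ}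
    (hinf : ∀ k, ∃ n ≥ k, (g n).isSome = true)
    (hψ : ∀ n b, g n = some b → t.get? (ψ n) = some b)
    (hmono : ∀ m n, m < n → (g m).isSome = true → (g n).isSome = true → ψ m < ψ n) :
    ∃ φ, IsSubseqVia φ (compress g) t := by
  have hi : {n | (g n).isSome = true}.Infinite := by
    rw [Set.infinite_iff_exists_gt]
    intro a
    obtain ⟨n, hn, h⟩ := hinf (a + 1)
    exact ⟨n, h, hn⟩
  refine ⟨fun k => ψ (Nat.nth (fun n => (g n).isSome = true) k), ?_, ?_⟩
  · intro a b hab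
    exact hmono _ _ (Nat.nth_strictMono hi hab) (Nat.nth_mem_of_infinite hi a)
      (Nat.nth_mem_of_infinite hi b)
  · intro k b hk
    obtain ⟨n, hn, rfl⟩ := compress_get?_eq_some.1 hk
    have h := Nat.nth_count (p := fun n => (g n).isSome = true) (n := n) (by simp [hn])
    simp only [h]
    exact hψ n b hn

end Compress

/-! ### Stuttering runs -/

namespace Automaton

variable {α : Type} (A : Automaton α)

/-- A step by the given action, or no step at all. -/
def StutterStep (s : A.State) : Option A.Action → A.State → Prop
  | none, s' => s' = s
  | some x, s' => A.trans s x s'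

/-- A fair run in which some of the time instants carry no event. -/
structure StutterRun (g : ℕ → Option A.Action) (st : ℕ → A.State) : Prop where
  initial_mem : st 0 ∈ A.initial
  step : ∀ n, A.StutterStep (st n) (g n) (st (n + 1))
  fair : ∀ T, (∀ k, ∃ n ≥ k, ∃ x ∈ A.task T, g n = some x) ∨
    ∀ k, ∃ n ≥ k, ¬ A.TaskEnabled (st n) T

variable {A}

/-- A finite execution is continued by idling in its last state. Fairness says that no task is
enabled there, which is the second alternative of stuttering fairness. -/
theorem Execution.Fair.exists_stutterRun {e : A.Execution} (he : e.Fair) :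
    ∃ st, A.StutterRun e.ev.get? st := by
  by_cases hinf : IsInfinite e.ev
  · refine ⟨e.st, e.initial_mem, ?_, fun T => ?_⟩
    · intro n
      obtain ⟨x, hx⟩ := Option.isSome_iff_exists.1 (hinf n)
      rw [hx]
      exact e.step n x hx
    · exact (he T).2 hinf
  · have hex : ∃ m, e.ev.get? m = none := by
      simpa [IsInfinite] using hinf
    classical
    set L := Nat.find hex with hL
    have hnone : ∀ m, L ≤ m → e.ev.get? m = none := fun m hm =>
      Stream'.Seq.le_stable _ hm (Nat.find_spec hex)
    have hlen : HasLength e.ev L := by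
      intro m
      constructor
      · intro h
        by_contra hm
        simp [hnone m (not_lt.1 hm)] at h
      · intro h
        exact Option.isSome_iff_ne_none.2 (Nat.find_min hex h)
    refine ⟨fun n => e.st (min n L), by simpa using e.initial_mem, ?_, fun T => Or.inr ?_⟩
    · intro n
      by_cases hn : n < L
      · obtain ⟨x, hx⟩ := Option.isSome_iff_exists.1 ((hlen n).2 hn)
        rw [hx, min_eq_left hn.le, min_eq_left (Nat.succ_le_of_lt hn)]
        exact e.step n x hx
      · rw [hnone n (not_lt.1 hn), min_eq_right (not_lt.1 hn), min_eq_right (by omega)]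
        rfl
    · intro k
      exact ⟨max k L, le_max_left _ _, by simpa using (he T).1 L hlen⟩

/-- Idle instants do not change the state, so deleting them yields an execution. As infinitely many
events remain, only the infinite clause of fairness matters. -/
theorem StutterRun.fairTrace {g : ℕ → Option A.Action} {st : ℕ → A.State}
    (h : A.StutterRun g st) (hinf : ∀ k, ∃ n ≥ k, (g n).isSome = true) :
    A.FairTrace (compress fun n => (g n).bind Sum.getLeft?) := by
  set p : ℕ → Prop := fun n => (g n).isSome = true with hp
  have hi : {n | p n}.Infinite := by
    rw [Set.infinite_iff_exists_gt]
    intro a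
    obtain ⟨n, hn, h⟩ := hinf (a + 1)
    exact ⟨n, h, hn⟩
  -- Induction on the distance `d` from `n` to the next event: the state is constant on this gap.
  have hst : ∀ d n, Nat.nth p (Nat.count p n) = n + d → st (Nat.nth p (Nat.count p n)) = st n := by
    intro d
    induction d with
    | zero => intro n hn; rw [hn]; rfl
    | succ d ih =>
      intro n hn
      have hpn : ¬ p n := fun hpn => by
        rw [Nat.nth_count hpn] at hn
        omega
      have hc : Nat.count p (n + 1) = Nat.count p n := by rw [Nat.count_succ, if_neg hpn]; rfl
      have h1 := ih (n + 1) (by rw [hc, hn]; omega)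
      have hg : g n = none := by simpa [p] using hpn
      have h2 := h.step n
      rw [hg] at h2
      rw [hc] at h1
      rw [h1]
      exact h2
  have hst' : ∀ n, st (Nat.nth p (Nat.count p n)) = st n := fun n => by
    obtain ⟨d, hd⟩ := Nat.exists_eq_add_of_le (Nat.le_nth_count hi n)
    exact hst d n hd
  have hcount : ∀ k n, Nat.nth p k ≤ n → k ≤ Nat.count p n := fun k n hkn => by
    rw [← Nat.count_nth_of_infinite hi k]
    exact Nat.count_monotone p hkn
  have hall : ∀ k, ∃ x, (compress g).get? k = some x ∧ g (Nat.nth p k) = some x := fun k => by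
    obtain ⟨x, hx⟩ := Option.isSome_iff_exists.1 (Nat.nth_mem_of_infinite hi k)
    exact ⟨x, compress_get?_eq_some.2 ⟨_, hx, Nat.count_nth_of_infinite hi k⟩, hx⟩
  have hIs : IsInfinite (compress g) := fun k => by
    obtain ⟨x, hx, -⟩ := hall k
    simp [hx]
  refine ⟨⟨compress g, fun k => st (Nat.nth p k), ?_, ?_⟩, ?_, ?_⟩
  · have := hst' 0
    rw [Nat.count_zero] at this
    rw [this]
    exact h.initial_mem
  · intro k x hx
    obtain ⟨y, hy, hgy⟩ := hall k
    rw [hx] at hy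
    cases hy
    have h1 := h.step (Nat.nth p k)
    rw [hgy] at h1
    have h2 := hst' (Nat.nth p k + 1)
    rw [Nat.count_succ, if_pos (Nat.nth_mem_of_infinite hi k), Nat.count_nth_of_infinite hi k] at h2
    show A.trans (st (Nat.nth p k)) x (st (Nat.nth p (k + 1)))
    rw [h2]
    exact h1
  · intro T
    refine ⟨fun k hk => ?_, fun _ => ?_⟩
    · exact absurd ((hk k).1 (hIs k)) (lt_irrefl k)
    · rcases h.fair T with hT | hT
      · refine Or.inl fun k => ?_
        obtain ⟨n, hn, x, hx, hgx⟩ := hT (Nat.nth p k)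
        exact ⟨Nat.count p n, hcount k n hn, x, hx, compress_get?_count hgx⟩
      · refine Or.inr fun k => ?_
        obtain ⟨n, hn, hd⟩ := hT (Nat.nth p k)
        exact ⟨Nat.count p n, hcount k n hn, by simpa only [hst' n] using hd⟩
  · exact compress_bind_compress g _

end Automaton

end AFD

namespace AFD

/-! ### Steps of a composition -/

section Compose

variable {α κ : Type} {A : κ → Automaton α} {hA : Compatible A}

/-- The effect of an action of a composition on the component `k`. -/
def LocalStep (A : κ → Automaton α) (k : κ) :
    (α ⊕ Σ k, (A k).Int) → (A k).State → (A k).State → Prop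
  | Sum.inl a, s, s' => (a ∈ (A k).ext → (A k).trans s (Sum.inl a) s') ∧ (a ∉ (A k).ext → s' = s)
  | Sum.inr h, s, s' =>
      (∀ e : h.1 = k, (A k).trans s (Sum.inr (e ▸ h.2)) s') ∧ (h.1 ≠ k → s' = s)

/-- Some component takes part in the action. -/
def TakesPart (A : κ → Automaton α) : (α ⊕ Σ k, (A k).Int) → Prop
  | Sum.inl a => ∃ k, a ∈ (A k).ext
  | Sum.inr _ => True

/-- Reduces the construction of a step to an independent choice of one local step per component. -/
theorem compose_trans_iff {s s' : (compose A hA).State} {x : (compose A hA).Action} :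
    (compose A hA).trans s x s' ↔ TakesPart A x ∧ ∀ k, LocalStep A k x (s k) (s' k) := by
  rcases x with a | ⟨k₀, h⟩
  · exact Iff.rfl
  · constructor
    · rintro ⟨h1, h2⟩
      refine ⟨trivial, fun k => ⟨?_, fun hk => h2 k (Ne.symm hk)⟩⟩
      rintro rfl
      exact h1
    · rintro ⟨-, h2⟩
      exact ⟨(h2 k₀).1 rfl, fun k hk => (h2 k).2 (Ne.symm hk)⟩

theorem Automaton.task_inl_mem_out {B : Automaton α} {T : B.Task} {a : α}
    (h : Sum.inl a ∈ B.task T) : a ∈ B.out := by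
  rcases (B.task_cover _).1 ⟨T, h⟩ with ⟨b, hb, hab⟩ | ⟨h, hh⟩
  · cases hab; exact hb
  · cases hh

theorem Automaton.isLocal_of_mem_task {B : Automaton α} {T : B.Task} {x : B.Action}
    (h : x ∈ B.task T) : B.IsLocal x := (B.task_cover x).1 ⟨T, h⟩

/-- The action of the composition that is given by an action of the component `k`. -/
def liftAct (A : κ → Automaton α) (k : κ) : (A k).Action → α ⊕ Σ k, (A k).Int
  | Sum.inl a => Sum.inl a
  | Sum.inr h => Sum.inr ⟨k, h⟩

theorem mem_compose_task {k : κ} {T : (A k).Task} {x : (compose A hA).Action} :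
    x ∈ (compose A hA).task ⟨k, T⟩ ↔ ∃ y ∈ (A k).task T, x = liftAct A k y := by
  constructor
  · rintro (⟨a, ha, rfl⟩ | ⟨h, hh, rfl⟩)
    · exact ⟨_, ha, rfl⟩
    · exact ⟨_, hh, rfl⟩
  · rintro ⟨y | y, hy, rfl⟩
    · exact Or.inl ⟨y, hy, rfl⟩
    · exact Or.inr ⟨y, hy, rfl⟩

theorem localStep_liftAct {k : κ} {T : (A k).Task} {y : (A k).Action} (hy : y ∈ (A k).task T)
    {s s' : (A k).State} (h : LocalStep A k (liftAct A k y) s s') : (A k).trans s y s' := by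
  rcases y with a | y
  · exact h.1 (Or.inr (Automaton.task_inl_mem_out hy))
  · exact h.1 rfl

theorem exists_localStep_input {a : α} {k : κ} (ha : a ∉ (A k).out) (s : (A k).State) :
    ∃ s', LocalStep A k (Sum.inl a) s s' := by
  by_cases hk : a ∈ (A k).ext
  · obtain ⟨s', hs'⟩ := (A k).input_enabled a (hk.resolve_right ha) s
    exact ⟨s', fun _ => hs', fun hn => absurd hk hn⟩
  · exact ⟨s, fun hn => absurd hn hk, fun _ => rfl⟩

/-- Other components cannot block a task: by compatibility its action is not an output of theirs,
and inputs are always enabled. -/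
theorem compose_taskEnabled_iff {s : (compose A hA).State} {k : κ} {T : (A k).Task} :
    (compose A hA).TaskEnabled s ⟨k, T⟩ ↔ (A k).TaskEnabled (s k) T := by
  constructor
  · rintro ⟨x, hx, s', hs'⟩
    obtain ⟨y, hy, rfl⟩ := mem_compose_task.1 hx
    exact ⟨y, hy, s' k, localStep_liftAct hy ((compose_trans_iff.1 hs').2 k)⟩
  · rintro ⟨y, hy, s₁, hs₁⟩
    refine ⟨_, mem_compose_task.2 ⟨y, hy, rfl⟩, ?_⟩
    have h : ∀ k', ∃ s', LocalStep A k' (liftAct A k y) (s k') s' := by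
      intro k'
      by_cases hk : k = k'
      · subst hk
        refine ⟨s₁, ?_⟩
        rcases y with a | y
        · exact ⟨fun _ => hs₁, fun hn => absurd (Or.inr (Automaton.task_inl_mem_out hy)) hn⟩
        · exact ⟨fun _ => hs₁, fun hn => absurd rfl hn⟩
      · rcases y with a | y
        · refine exists_localStep_input (fun ha => ?_) _
          exact Set.disjoint_left.1 (hA k k' hk) (Automaton.task_inl_mem_out hy) ha
        · exact ⟨s k', fun e => absurd e hk, fun _ => rfl⟩
    choose s' hs' using h
    refine ⟨s', compose_trans_iff.2 ⟨?_, hs'⟩⟩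
    rcases y with a | y
    · exact ⟨k, Or.inr (Automaton.task_inl_mem_out hy)⟩
    · trivial

end Compose

/-! ### Interleaving -/

/-- Dependent choice. The invariant `P` may depend on `n`, so that a clause of the form `n = 0 → …`
can fix the starting point. -/
theorem exists_seq_of_step {σ : Type} {P : ℕ → σ → Prop} {R : ℕ → σ → σ → Prop}
    (h0 : ∃ s, P 0 s) (hs : ∀ n s, P n s → ∃ s', P (n + 1) s' ∧ R n s s') :
    ∃ st : ℕ → σ, ∀ n, P n (st n) ∧ R n (st n) (st (n + 1)) := by
  obtain ⟨s0, h0⟩ := h0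
  have : Nonempty σ := ⟨s0⟩
  choose! nx hnx using hs
  let st : ℕ → σ := fun n => Nat.rec s0 (fun n s => nx n s) n
  have hP : ∀ n, P n (st n) := by
    intro n
    induction n with
    | zero => exact h0
    | succ n ih => exact (hnx n _ ih).1
  exact ⟨st, fun n => ⟨hP n, (hnx n _ (hP n)).2⟩⟩

/-- A function on `ℕ` that starts at `0`, grows by at most one at each step, and is unbounded,
leaves every value upwards. -/
theorem exists_step_of_unbounded {F : ℕ → ℕ} (h0 : F 0 = 0) (hstep : ∀ n, F (n + 1) ≤ F n + 1)
    (hunb : ∀ k, ∃ n, k ≤ F n) (m : ℕ) : ∃ n, F n = m ∧ F (n + 1) = m + 1 := by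
  classical
  have hex : ∃ n, m < F n := (hunb (m + 1)).imp fun n hn => hn
  obtain ⟨n, hn⟩ : ∃ n, Nat.find hex = n + 1 := by
    refine Nat.exists_eq_succ_of_ne_zero fun h => ?_
    have := Nat.find_spec hex
    rw [h, h0] at this
    omega
  have h1 := Nat.find_spec hex
  have h2 := Nat.find_min hex (m := n) (by omega)
  rw [hn] at h1
  have h3 := hstep n
  exact ⟨n, by omega, by omega⟩

/-- A schedule that interleaves two sequences of events: `K n` events of the first one and
`M n` events of the second one occur before time `n`, and the first `b k` events of the second
one are those that precede the `k`-th event of the first one. -/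
theorem exists_schedule {b : ℕ → ℕ} (hb : Monotone b) (hunb : ∀ m, ∃ k, m ≤ b k) :
    ∃ K M : ℕ → ℕ, K 0 = 0 ∧ M 0 = 0 ∧
      (∀ n, (K (n + 1) = K n ∧ M (n + 1) = M n + 1) ∨
        (K (n + 1) = K n + 1 ∧ M (n + 1) = M n ∧ M n = b (K n))) ∧
      (∀ k, ∃ n, k ≤ K n) ∧ ∀ m, ∃ n, m ≤ M n := by
  -- The greedy schedule: with counters `(k, m)`, advance `m` until it reaches `b k`, then advance
  -- `k`.
  obtain ⟨st, hst⟩ := exists_seq_of_step (σ := ℕ × ℕ)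
    (P := fun n s => s.2 ≤ b s.1 ∧ (n = 0 → s = (0, 0)))
    (R := fun _ s s' => (s.2 < b s.1 ∧ s' = (s.1, s.2 + 1)) ∨ (s.2 = b s.1 ∧ s' = (s.1 + 1, s.2)))
    ⟨(0, 0), Nat.zero_le _, fun _ => rfl⟩ (by
      rintro n ⟨k, m⟩ ⟨hle, -⟩
      rcases lt_or_eq_of_le hle with h | h
      · exact ⟨(k, m + 1), ⟨h, by simp⟩, Or.inl ⟨h, rfl⟩⟩
      · exact ⟨(k + 1, m), ⟨hle.trans (hb (Nat.le_succ k)), by simp⟩, Or.inr ⟨h, rfl⟩⟩)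
  have h0 : st 0 = (0, 0) := (hst 0).1.2 rfl
  have hR := fun n => (hst n).2
  have hK : ∀ k, ∃ n, k ≤ (st n).1 := by
    intro k
    induction k with
    | zero => exact ⟨0, Nat.zero_le _⟩
    | succ k ih =>
      obtain ⟨n, hn⟩ := ih
      by_contra hcon
      push Not at hcon
      -- If the first counter stalled forever, the second would grow at every step and exceed `b` of
      -- the stalled value.
      have hall : ∀ d, (st (n + d)).1 = (st n).1 ∧ (st (n + d)).2 = (st n).2 + d := by
        intro d
        induction d with
        | zero => exact ⟨rfl, rfl⟩
        | succ d ihd =>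
          rcases hR (n + d) with ⟨-, h⟩ | ⟨-, h⟩
          · rw [← add_assoc, h]
            exact ⟨ihd.1, by simp only [ihd.2]; omega⟩
          · have h1 := hcon (n + d + 1)
            have h2 := hcon n
            rw [h] at h1
            simp only at h1
            omega
      have h1 := hall (b (st n).1 + 1)
      have h2 := (hst (n + (b (st n).1 + 1))).1.1
      rw [h1.1, h1.2] at h2
      omega
  refine ⟨fun n => (st n).1, fun n => (st n).2, by simp [h0], by simp [h0], ?_, hK, ?_⟩
  · intro n
    rcases hR n with ⟨-, h⟩ | ⟨h1, h⟩
    · exact Or.inl (by simp [h])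
    · exact Or.inr (by simp [h, h1])
  · intro m
    obtain ⟨k, hk⟩ := hunb m
    have hKstep : ∀ n, (st (n + 1)).1 ≤ (st n).1 + 1 := fun n => by
      rcases hR n with ⟨-, h⟩ | ⟨-, h⟩ <;> simp [h]
    -- At the instant when the first counter leaves `k`, the second equals `b k ≥ m`.
    obtain ⟨n, hn, hn'⟩ := exists_step_of_unbounded (F := fun n => (st n).1) (by simp [h0])
      hKstep hK k
    rcases hR n with ⟨-, h⟩ | ⟨h1, -⟩
    · simp only [h] at hn hn'
      omega
    · exact ⟨n, hk.trans (hn ▸ h1.ge)⟩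

/-- If `P k` grows to infinity and `p`, `q` hold equally often, then there are counts `b k` that
grow to infinity such that `q` holds as often below `b k` as `p` does below `P k`. -/
theorem exists_matching_counts {p q : ℕ → Prop} [DecidablePred p] [DecidablePred q]
    (hpq : ∀ m, p m → ∃ n, q n ∧ Nat.count q n = Nat.count p m)
    (hqp : ∀ n, q n → ∃ m, p m ∧ Nat.count p m = Nat.count q n)
    {P : ℕ → ℕ} (hP : Monotone P) (hunb : ∀ m, ∃ k, m ≤ P k) :
    ∃ b : ℕ → ℕ, Monotone b ∧ (∀ m, ∃ k, m ≤ b k) ∧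
      ∀ k, Nat.count q (b k) = Nat.count p (P k) := by
  classical
  have hlevel : ∀ m, ∃ n, Nat.count q n = Nat.count p m := by
    intro m
    induction m with
    | zero => exact ⟨0, by simp⟩
    | succ m ih =>
      rw [Nat.count_succ]
      split_ifs with h
      · obtain ⟨n, hn, hc⟩ := hpq m h
        exact ⟨n + 1, by rw [Nat.count_succ, if_pos hn, hc]⟩
      · exact ih
  have hgrow : ∀ k d n, Nat.count q n = k → ∃ n', Nat.count q n' = k ∧ (n + d ≤ n' ∨ q n') := by
    intro k d
    induction d with
    | zero => exact fun n hn => ⟨n, hn, Or.inl le_rfl⟩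
    | succ d ih =>
      intro n hn
      by_cases h : q n
      · exact ⟨n, hn, Or.inr h⟩
      · obtain ⟨n', h1, h2⟩ := ih (n + 1) (by rw [Nat.count_succ, if_neg h, hn, add_zero])
        exact ⟨n', h1, h2.imp_left fun h => by omega⟩
  -- Among the `n` with the right count, `b k` is the least that is at least `k` or at which `q`
  -- holds. The alternative makes `b` grow without bound even when `q` holds only finitely often.
  have hex : ∀ k, ∃ n, Nat.count q n = Nat.count p (P k) ∧ (k ≤ n ∨ q n) := by
    intro k
    obtain ⟨n, hn⟩ := hlevel (P k)
    obtain ⟨n', h1, h2⟩ := hgrow _ k n hn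
    exact ⟨n', h1, h2.imp_left fun h => by omega⟩
  have hmono : Monotone fun k => Nat.find (hex k) := by
    refine monotone_nat_of_le_succ fun k => ?_
    have h1 := Nat.find_spec (hex (k + 1))
    rcases (Nat.count_monotone p (hP (Nat.le_succ k))).lt_or_eq with h | h
    · by_contra hcon
      have h2 := Nat.count_monotone q (not_le.1 hcon).le
      rw [h1.1, (Nat.find_spec (hex k)).1] at h2
      exact absurd h (not_lt.2 h2)
    · exact Nat.find_min' _ ⟨h1.1.trans h.symm, h1.2.imp_left fun h => by omega⟩
  refine ⟨fun k => Nat.find (hex k), hmono, ?_, fun k => (Nat.find_spec (hex k)).1⟩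
  intro m
  induction m with
  | zero => exact ⟨0, Nat.zero_le _⟩
  | succ m ih =>
    obtain ⟨k, hk⟩ := ih
    -- If `q m` holds, `b` passes `m` as soon as `P` has passed the matching place of `p`. If not,
    -- the choice of `b` forbids the value `m` at indices above `m`.
    by_cases hqm : q m
    · obtain ⟨j, hj, hc⟩ := hqp m hqm
      obtain ⟨k', hk'⟩ := hunb (j + 1)
      refine ⟨k', ?_⟩
      have h1 := (Nat.find_spec (hex k')).1
      have h2 : Nat.count p j < Nat.count p (P k') := Nat.count_strict_mono hj (by omega)
      rw [hc, ← h1, count_lt_count_iff hqm] at h2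
      exact h2
    · refine ⟨max k (m + 1), ?_⟩
      have h1 : Nat.find (hex k) ≤ Nat.find (hex (max k (m + 1))) := hmono (le_max_left _ _)
      have h2 := (Nat.find_spec (hex (max k (m + 1)))).2
      by_contra hcon
      simp only at hk hcon
      rcases h2 with h2 | h2
      · have := le_max_right k (m + 1)
        omega
      · have : Nat.find (hex (max k (m + 1))) = m := by omega
        rw [this] at h2
        exact hqm h2

end AFD

namespace AFD

/-! ### Projections -/

section Filt

variable {α : Type}

open Classical in
/-- The partial identity with domain `B`. -/
noncomputable def filt (B : Set α) (a : α) : Option α := if a ∈ B then some a else none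

theorem bind_filt_eq_some {B : Set α} {o : Option α} {a : α} :
    o.bind (filt B) = some a ↔ o = some a ∧ a ∈ B := by
  rcases o with _ | b
  · simp
  · by_cases hb : b ∈ B
    · simp only [filt, hb, Option.bind_some, if_true, Option.some.injEq]
      exact ⟨fun h => ⟨h, h ▸ hb⟩, fun h => h.1⟩
    · simp only [filt, hb, Option.bind_some, if_false, Option.some.injEq, reduceCtorEq, false_iff]
      rintro ⟨rfl, h⟩
      exact hb h

theorem isSome_bind_filt {B : Set α} {o : Option α} :
    (o.bind (filt B)).isSome = true ↔ ∃ a ∈ B, o = some a := by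
  rw [Option.isSome_iff_exists]
  simp only [bind_filt_eq_some]
  exact ⟨fun ⟨a, h, h'⟩ => ⟨a, h', h⟩, fun ⟨a, h, h'⟩ => ⟨a, h', h⟩⟩

theorem proj_eq (B : Set α) (t : Seq α) : proj B t = compress fun n => (t.get? n).bind (filt B) :=
  rfl

theorem proj_compress_filt (B : Set α) (g : ℕ → Option α) :
    proj B (compress g) = compress fun n => (g n).bind (filt B) :=
  compress_bind_compress g _

end Filt

variable {ι M : Type} {O : ι → Type}

/-! ### Observations -/

namespace Observation

variable {G : Observation ι O}

/-- The `k`-th output of `t` is the action of the `k`-th vertex of the ordering, so a vertex can be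
sent to the place of that output in `t`; edges then increase the position. -/
theorem IsCompatibleWith.exists_position {t : Seq (Act ι M O)} (h : G.IsCompatibleWith t) :
    ∃ pos : Vertex ι O → ℕ, (∀ w ∈ G.V, t.get? (pos w) = some w.act) ∧
      (∀ u ∈ G.V, ∀ w ∈ G.V, pos u = pos w → u = w) ∧ (∀ u w, G.Z u w → pos u < pos w) ∧
      ∀ n i o, t.get? n = some (Act.fd i o) → ∃ w ∈ G.V, pos w = n := by
  obtain ⟨s, ⟨hover, hall, hord⟩, hproj⟩ := h
  rw [proj_eq] at hproj
  set p : ℕ → Prop := fun n => ((t.get? n).bind (filt (fdActs : Set (Act ι M O)))).isSome = true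
    with hp
  have hex : ∀ w ∈ G.V, ∃ n, t.get? n = some w.act ∧ p n ∧ s.get? (Nat.count p n) = some w := by
    intro w hw
    obtain ⟨j, hj, -⟩ := hall w hw
    have h1 : (s.map (Vertex.act (M := M))).get? j = some w.act := by simp [hj]
    rw [← hproj] at h1
    obtain ⟨n, hn, rfl⟩ := compress_get?_eq_some.1 h1
    have h2 := (bind_filt_eq_some.1 hn)
    exact ⟨n, h2.1, by simp [hp, hn], hj⟩
  choose! pos h1 h2 h3 using hex
  refine ⟨pos, h1, ?_, ?_, ?_⟩
  · intro u hu w hw huw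
    have h4 := h3 u hu
    rw [huw, h3 w hw] at h4
    exact (Option.some.inj h4).symm
  · intro u w huw
    obtain ⟨hu, hw⟩ := G.edge_mem u w huw
    exact (count_lt_count_iff (h2 u hu)).1 (hord _ _ _ _ (h3 u hu) (h3 w hw) huw)
  · intro n i o hn
    have hpn : (t.get? n).bind (filt (fdActs : Set (Act ι M O))) = some (Act.fd i o) :=
      bind_filt_eq_some.2 ⟨hn, i, o, rfl⟩
    have h4 := compress_get?_count
      (g := fun n => (t.get? n).bind (filt (fdActs : Set (Act ι M O)))) hpn
    rw [hproj, Stream'.Seq.map_get?] at h4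
    obtain ⟨w, hw, -⟩ := Option.map_eq_some_iff.1 h4
    have hwV := hover _ _ hw
    refine ⟨w, hwV, ?_⟩
    obtain ⟨m, -, hm⟩ := hall w hwV
    have h5 := hm _ hw
    have h6 := hm _ (h3 w hwV)
    refine Nat.count_injective (h2 w hwV) ?_ (h6.trans h5.symm)
    simp [hp, hpn]

theorem followsAt_none {i : ι} {v : Option (Vertex ι O)} (h : G.FollowsAt v i) :
    G.FollowsAt none i := by
  obtain ⟨w, hw, hi⟩ := h
  refine ⟨w, ?_, hi⟩
  rcases v with _ | u
  · exact hw
  · exact (G.edge_mem u w hw).2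

/-- From another location `edge_live` gives the edge. From a vertex at `i` itself, infinitely many
vertices and `idx_down` provide the one with the next index. -/
theorem followsAt_of_live {i : ι} (hi : i ∈ G.live) {v : Option (Vertex ι O)}
    (hv : ∀ u, v = some u → u ∈ G.V) : G.FollowsAt v i := by
  rcases v with _ | u
  · obtain ⟨w, hw, hwi⟩ := Set.Infinite.nonempty hi
    exact ⟨w, hw, hwi⟩
  · have hu := hv u rfl
    by_cases hui : u.loc = i
    · have hinj : Set.InjOn Vertex.idx {v ∈ G.V | v.loc = i} := fun a ha b hb hab =>
        G.idx_unique a ha.1 b hb.1 (ha.2.trans hb.2.symm) hab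
      have hinf := Set.Infinite.image hinj hi
      obtain ⟨_, ⟨w, hw, rfl⟩, hlt⟩ := hinf.exists_gt u.idx
      have hex : ∃ x ∈ G.V, x.loc = i ∧ x.idx = u.idx + 1 := by
        rcases lt_or_eq_of_le (Nat.succ_le_of_lt hlt) with h | h
        · obtain ⟨x, hx, hxl, hxi⟩ := G.idx_down w hw.1 (u.idx + 1) (Nat.succ_pos _) h
          exact ⟨x, hx, hxl.trans hw.2, hxi⟩
        · exact ⟨w, hw.1, hw.2, h.symm⟩
      obtain ⟨x, hx, hxl, hxi⟩ := hex
      exact ⟨x, G.edge_succ u hu x hx (hui.trans hxl.symm) hxi, hxl⟩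
    · obtain ⟨w, -, hwi, hw⟩ := G.edge_live u.loc i hui hi u hu rfl
      exact ⟨w, hw, hwi⟩

end Observation

/-! ### Nodes and edges of the tree -/

section TreeFacts

variable {A E : ι → Automaton (Act ι M O)} {hS : Compatible (sysFamily A E)}
  {G : Observation ι O}

theorem IsNode.edge {e : Edge A E hS} {N : Node A E hS} (h : IsNode G (e :: N)) :
    IsNode G N ∧ IsEdgeOf G N e := by
  cases h with
  | child _ _ h1 h2 => exact ⟨h1, h2⟩

theorem IsNode.of_suffix {N N' : Node A E hS} (h : IsNode G N') (hs : N <:+ N') : IsNode G N := by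
  obtain ⟨L, rfl⟩ := hs
  induction L with
  | nil => exact h
  | cons e L ih => exact ih h.edge.1

/-- An edge with an action tag is either a step of a task or a failure-detector output. -/
theorem IsEdgeOf.act_cases {N : Node A E hS} {e : Edge A E hS} (h : IsEdgeOf G N e)
    {x : (sys A E hS).Action} (hx : e.act = some x) :
    (∃ k T, e.label = Label.task k T ∧ MayAct G N.vtag k ∧ x ∈ (sys A E hS).task ⟨k, T⟩ ∧
      e.vtag = N.vtag) ∨
    ∃ w, e.label = Label.FD w.loc ∧ G.Follows N.vtag w ∧ e.vtag = some w ∧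
      x = Sum.inl w.act := by
  obtain ⟨-, h1, h2, -⟩ := h
  rcases hl : e.label with ⟨k, T⟩ | i
  · rw [hl] at h1 h2
    rcases h2 with ⟨hm, a, ha, -, hxa⟩ | ⟨-, hn⟩
    · rw [hx] at hxa
      cases hxa
      exact Or.inl ⟨k, T, rfl, hm, ha, h1⟩
    · rw [hx] at hn; cases hn
  · rw [hl] at h1 h2
    rcases h2 with ⟨w, hw, hne, hxa⟩ | ⟨-, hn⟩
    · rw [hx] at hxa
      cases hxa
      rcases h1 with ⟨w', hw', hi, hw''⟩ | ⟨-, hv⟩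
      · rw [hw] at hw''
        cases hw''
        exact Or.inr ⟨w, by rw [hi], hw', hw, rfl⟩
      · exact absurd hv hne
    · rw [hx] at hn; cases hn

theorem IsEdgeOf.vtag_cases {N : Node A E hS} {e : Edge A E hS} (h : IsEdgeOf G N e) :
    e.vtag = N.vtag ∨ ∃ w, G.Follows N.vtag w ∧ e.vtag = some w := by
  obtain ⟨-, h1, -, -⟩ := h
  rcases hl : e.label with ⟨k, T⟩ | i
  · rw [hl] at h1
    exact Or.inl h1
  · rw [hl] at h1
    rcases h1 with ⟨w, hw, -, hv⟩ | ⟨-, hv⟩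
    · exact Or.inr ⟨w, hw, hv⟩
    · exact Or.inl hv

theorem IsEdgeOf.act_eq_none {N : Node A E hS} {e : Edge A E hS} (h : IsEdgeOf G N e)
    (hx : e.act = none) : e.vtag = N.vtag ∧ e.cfg = N.cfg := by
  obtain ⟨-, h1, h2, h3⟩ := h
  rw [hx] at h3
  refine ⟨?_, h3⟩
  rcases hl : e.label with ⟨k, T⟩ | i
  · rw [hl] at h1
    exact h1
  · rw [hl, hx] at h2
    rcases h2 with ⟨w, -, -, hw⟩ | ⟨hv, -⟩
    · cases hw
    · exact hv

theorem IsEdgeOf.trans {N : Node A E hS} {e : Edge A E hS} (h : IsEdgeOf G N e)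
    {x : (sys A E hS).Action} (hx : e.act = some x) : (sys A E hS).trans N.cfg x e.cfg := by
  have h3 := h.2.2.2
  rw [hx] at h3
  exact h3

theorem IsNode.vtag_mem {N : Node A E hS} (h : IsNode G N) :
    ∀ u, N.vtag = some u → u ∈ G.V := by
  induction h with
  | root => intro u hu; cases hu
  | child N e hN he ih =>
    intro u hu
    rcases he.vtag_cases with h | ⟨w, hw, hv⟩
    · exact ih u (h ▸ hu)
    · have hu' : e.vtag = some u := hu
      rw [hv] at hu'
      cases hu'
      rcases hvt : N.vtag with _ | x
      · rw [hvt] at hw; exact hw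
      · rw [hvt] at hw; exact (G.edge_mem _ _ hw).2

theorem start_mem (B : Automaton (Act ι M O)) : B.start ∈ B.initial :=
  B.initial_nonempty.some_mem

theorem LocalStep.reflTransGen {α κ : Type} {A : κ → Automaton α} {k : κ}
    {x : α ⊕ Σ k, (A k).Int} {s s' : (A k).State} (h : LocalStep A k x s s') :
    Relation.ReflTransGen (A k).Step s s' := by
  rcases x with a | ⟨k', y⟩
  · by_cases ha : a ∈ (A k).ext
    · exact Relation.ReflTransGen.single ⟨_, h.1 ha⟩
    · rw [h.2 ha]
  · by_cases hk : k' = k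
    · exact Relation.ReflTransGen.single ⟨_, h.1 hk⟩
    · rw [h.2 hk]

/-- Needed because a crash is assumed to disable a component only when it occurs in a reachable
state. -/
theorem IsNode.reachable {N : Node A E hS} (h : IsNode G N) (k : Comp ι) :
    (sysFamily A E k).Reachable (N.cfg k) := by
  induction h with
  | root => exact ⟨_, start_mem (sys A E hS) k, Relation.ReflTransGen.refl⟩
  | child N e hN he ih =>
    obtain ⟨s₀, h0, h1⟩ := ih
    refine ⟨s₀, h0, h1.trans ?_⟩
    rcases hx : e.act with _ | x
    · have h2 := (he.act_eq_none hx).2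
      show Relation.ReflTransGen _ (N.cfg k) (e.cfg k)
      rw [h2]
    · exact ((compose_trans_iff.1 (he.trans hx)).2 k).reflTransGen

end TreeFacts

end AFD

namespace AFD

variable {ι M : Type} {O : ι → Type}

/-! ### Crashing the components of a system -/

/-- The automaton has a crash action among those that satisfy `cr`. -/
def Crashed (B : Automaton (Act ι M O)) (cr : ι → Prop) : Prop := ∃ i, cr i ∧ Act.crash i ∈ B.ext

/-- The state occurs after a crash. -/
def Dead (B : Automaton (Act ι M O)) (s : B.State) : Prop :=
  ∃ i s₀ s₁, B.Reachable s₀ ∧ B.trans s₀ (Sum.inl (Act.crash i)) s₁ ∧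
    Relation.ReflTransGen B.Step s₁ s

theorem Dead.not_taskEnabled {B : Automaton (Act ι M O)}
    (hB : ∀ i, Act.crash i ∈ B.ext → B.PermanentlyDisabledBy (Act.crash i)) {s : B.State}
    (h : Dead B s) (T : B.Task) : ¬ B.TaskEnabled s T := by
  obtain ⟨i, s₀, s₁, h0, h1, h2⟩ := h
  rintro ⟨x, hx, he⟩
  exact hB i (B.trans_ext _ _ _ h1) s₀ s₁ s h0 h1 h2 x (Automaton.isLocal_of_mem_task hx) he

section Full

variable {A E : ι → Automaton (Act ι M O)} {C : Automaton (Act ι M O)}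
  {h : Compatible (fullFamily A E C)}

variable (A E C) in
/-- Actions of the system as actions of the system with crashes. -/
def liftSys : (Act ι M O ⊕ Σ k, (sysFamily A E k).Int) → Act ι M O ⊕ Σ k, (fullFamily A E C k).Int
  | Sum.inl a => Sum.inl a
  | Sum.inr y => Sum.inr ⟨some y.1, y.2⟩

theorem localStep_liftSys {k : Comp ι} {x : Act ι M O ⊕ Σ k, (sysFamily A E k).Int}
    {s s' : (sysFamily A E k).State} (hs : LocalStep (sysFamily A E) k x s s') :
    LocalStep (fullFamily A E C) (some k) (liftSys A E C x) s s' := by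
  rcases x with a | ⟨k', y⟩
  · exact hs
  · refine ⟨fun e => ?_, fun hne => hs.2 fun e => hne (congrArg some e)⟩
    have e' : k' = k := Option.some.inj e
    subst e'
    exact hs.1 rfl

/-- Crashes are outputs of `C`, and compatible automata share no outputs. -/
theorem crash_notMem_out (h : Compatible (fullFamily A E C)) (hC : IsCrashAutomaton C)
    (k : Comp ι) (i : ι) : Act.crash i ∉ (sysFamily A E k).out := by
  intro hk
  refine Set.disjoint_left.1 (h none (some k) (by simp)) ?_ hk
  show Act.crash i ∈ C.out
  rw [hC.out_eq]
  exact ⟨i, rfl⟩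

theorem IsCrashAutomaton.ext_eq (hC : IsCrashAutomaton C) : C.ext = crashActs := by
  rw [Automaton.ext, hC.inp_eq, hC.out_eq, Set.empty_union]

/-- The state `s` of the system with crashes agrees with the state `c` of the system on the
components that have not crashed. -/
def Matches (c : ∀ k, (sysFamily A E k).State) (sC : C.State) (cr : ι → Prop)
    (s : ∀ k, (fullFamily A E C k).State) : Prop :=
  s none = sC ∧ ∀ k, (¬ Crashed (sysFamily A E k) cr → s (some k) = c k) ∧
    (Crashed (sysFamily A E k) cr → Dead (sysFamily A E k) (s (some k)))

/-- A crash is at most an input of the other components, so it can always be performed. A component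
hit for the first time is still in its tree state, which is reachable, and so becomes dead. -/
theorem Matches.exists_crash_step (hC : IsCrashAutomaton C)
    {c : ∀ k, (sysFamily A E k).State} (hreach : ∀ k, (sysFamily A E k).Reachable (c k))
    {sC sC' : C.State} {cr : ι → Prop} {s : ∀ k, (fullFamily A E C k).State}
    (hm : Matches c sC cr s) {o : Option C.Action} (ho : C.StutterStep sC o sC') :
    ∃ s', Matches c sC' (fun i => cr i ∨ o = some (Sum.inl (Act.crash i))) s' ∧
      (compose (fullFamily A E C) h).StutterStep s
        (o.map (liftAct (fullFamily A E C) none)) s' := by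
  rcases o with _ | (a | y)
  · refine ⟨s, ⟨?_, ?_⟩, rfl⟩
    · rw [hm.1]; exact ho.symm
    · simpa using hm.2
  · have ha : a ∈ C.ext := C.trans_ext _ _ _ ho
    rw [hC.ext_eq] at ha
    obtain ⟨i, rfl⟩ := ha
    have hex : ∀ k, ∃ s', LocalStep (fullFamily A E C) (some k) (Sum.inl (Act.crash i))
        (s (some k)) s' := fun k => exists_localStep_input (A := fullFamily A E C) (k := some k)
      (crash_notMem_out h hC k i) _
    choose s' hs' using hex
    refine ⟨fun | none => sC' | some k => s' k, ⟨rfl, fun k => ⟨fun hk => ?_, fun hk => ?_⟩⟩, ?_⟩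
    · have h1 : Act.crash i ∉ (sysFamily A E k).ext := fun h1 => hk ⟨i, Or.inr rfl, h1⟩
      exact ((hs' k).2 h1).trans ((hm.2 k).1 fun ⟨j, hj, hj'⟩ => hk ⟨j, Or.inl hj, hj'⟩)
    · by_cases hk' : Crashed (sysFamily A E k) cr
      · obtain ⟨j, s₀, s₁, h0, h1, h2⟩ := (hm.2 k).2 hk'
        exact ⟨j, s₀, s₁, h0, h1, h2.trans
          (LocalStep.reflTransGen (A := fullFamily A E C) (k := some k) (hs' k))⟩
      · obtain ⟨j, hj | hj, hj'⟩ := hk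
        · exact absurd ⟨j, hj, hj'⟩ hk'
        · have hji : i = j := by simpa using hj
          subst hji
          have h1 := (hs' k).1 hj'
          rw [(hm.2 k).1 hk'] at h1
          exact ⟨i, _, _, hreach k, h1, Relation.ReflTransGen.refl⟩
    · refine compose_trans_iff.2 ⟨⟨none, C.trans_ext _ _ _ ho⟩, ?_⟩
      rintro (_ | k)
      · refine ⟨fun _ => ?_, fun hn => absurd (C.trans_ext _ _ _ ho) hn⟩
        rw [hm.1]
        exact ho
      · exact hs' k
  · refine ⟨fun | none => sC' | some k => s (some k), ⟨rfl, ?_⟩, ?_⟩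
    · simpa using hm.2
    · refine compose_trans_iff.2 ⟨trivial, ?_⟩
      rintro (_ | k)
      · refine ⟨fun _ => ?_, fun hn => absurd rfl hn⟩
        rw [hm.1]
        exact ho
      · exact ⟨fun e => (by cases e), fun _ => rfl⟩

/-- A crashed component takes part in a tree step only through an input or not at all, as `hout` and
`hinternal` require. It can therefore follow from its own, possibly different, state and stays dead.
-/
theorem Matches.exists_sys_step (hC : IsCrashAutomaton C)
    {c c' : (sys A E h.sys).State} {sC : C.State} {cr : ι → Prop}
    {s : ∀ k, (fullFamily A E C k).State} (hm : Matches c sC cr s)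
    {x : (sys A E h.sys).Action} (hx : (sys A E h.sys).trans c x c')
    (hcr : ∀ i, x ≠ Sum.inl (Act.crash i))
    (hout : ∀ k, Crashed (sysFamily A E k) cr → ∀ a, x = Sum.inl a → a ∉ (sysFamily A E k).out)
    (hinternal : ∀ k, Crashed (sysFamily A E k) cr → ∀ y, x ≠ Sum.inr ⟨k, y⟩) :
    ∃ s', Matches c' sC cr s' ∧ (compose (fullFamily A E C) h).trans s (liftSys A E C x) s' := by
  obtain ⟨hpart, hloc⟩ := compose_trans_iff.1 hx
  have hex : ∀ k, ∃ s', LocalStep (sysFamily A E) k x (s (some k)) s' ∧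
      (¬ Crashed (sysFamily A E k) cr → s' = c' k) ∧
      (Crashed (sysFamily A E k) cr → Dead (sysFamily A E k) s') := by
    intro k
    by_cases hk : Crashed (sysFamily A E k) cr
    · have hstep : ∃ s', LocalStep (sysFamily A E) k x (s (some k)) s' := by
        rcases x with a | ⟨k', y⟩
        · exact exists_localStep_input (A := sysFamily A E) (hout k hk a rfl) _
        · refine ⟨s (some k), fun e => ?_, fun _ => rfl⟩
          simp only at e
          subst e
          exact absurd rfl (hinternal k' hk y)
      obtain ⟨s', hs'⟩ := hstep
      refine ⟨s', hs', fun hn => absurd hk hn, fun _ => ?_⟩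
      obtain ⟨j, s₀, s₁, h0, h1, h2⟩ := (hm.2 k).2 hk
      exact ⟨j, s₀, s₁, h0, h1, h2.trans hs'.reflTransGen⟩
    · refine ⟨c' k, ?_, fun _ => rfl, fun hn => absurd hn hk⟩
      rw [(hm.2 k).1 hk]
      exact hloc k
  choose s' hs' hs'' using hex
  refine ⟨fun | none => sC | some k => s' k, ⟨rfl, hs''⟩, compose_trans_iff.2 ⟨?_, ?_⟩⟩
  · rcases x with a | y
    · obtain ⟨k, hk⟩ := hpart
      exact ⟨some k, hk⟩
    · trivial
  · rintro (_ | k)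
    · rcases x with a | y
      · refine ⟨fun ha => ?_, fun _ => hm.1.symm⟩
        have ha' : a ∈ C.ext := ha
        rw [hC.ext_eq] at ha'
        obtain ⟨i, rfl⟩ := ha'
        exact absurd rfl (hcr i)
      · exact ⟨fun e => (by cases e), fun _ => hm.1.symm⟩
    · exact localStep_liftSys (hs' k)

end Full

/-! ### Branches of the tree -/

section Branch

variable {A E : ι → Automaton (Act ι M O)} {hS : Compatible (sysFamily A E)}
  {G : Observation ι O}

/-- The nodes of the branch with the given edges. -/
def branchNode (e : ℕ → Edge A E hS) : ℕ → Node A E hS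
  | 0 => []
  | k + 1 => e k :: branchNode e k

/-- The edges of a branch of the tree in which every label occurs infinitely often. -/
structure IsFairBranch (G : Observation ι O) (e : ℕ → Edge A E hS) : Prop where
  isNode : ∀ k, IsNode G (branchNode e k)
  fair : ∀ l k, ∃ n ≥ k, (e n).label = l

theorem IsFairBranch.isEdgeOf {e : ℕ → Edge A E hS} (he : IsFairBranch G e) (k : ℕ) :
    IsEdgeOf G (branchNode e k) (e k) :=
  (he.isNode (k + 1)).edge.2

theorem IsFairBranch.mayFollow {e : ℕ → Edge A E hS} (he : IsFairBranch G e) {i : ι}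
    (hi : i ∈ G.live) (k : ℕ) : G.FollowsAt (branchNode e k).vtag i :=
  Observation.followsAt_of_live hi (he.isNode k).vtag_mem

theorem Observation.Follows.ne {v : Option (Vertex ι O)} {w : Vertex ι O} (h : G.Follows v w) :
    v ≠ some w := by
  rintro rfl
  exact G.acyclic w (Relation.TransGen.single h)

/-- At a live location some vertex always may follow, and acyclicity makes it differ from the
current tag; so an edge labelled `FD i` never has action tag `⊥`. -/
theorem IsFairBranch.exists_output {e : ℕ → Edge A E hS} (he : IsFairBranch G e) {i : ι}
    (hi : i ∈ G.live) (k : ℕ) : ∃ n ≥ k, ∃ w, w.loc = i ∧ G.Follows (branchNode e n).vtag w ∧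
      (e n).vtag = some w ∧ (e n).act = some (Sum.inl w.act) := by
  obtain ⟨n, hn, hl⟩ := he.fair (Label.FD i) k
  obtain ⟨-, h1, h2, -⟩ := he.isEdgeOf n
  rw [hl] at h1 h2
  rcases h1 with ⟨w, hw, hwi, hv⟩ | ⟨hno, -⟩
  · refine ⟨n, hn, w, hwi, hw, hv, ?_⟩
    rcases h2 with ⟨w', hw', -, hx⟩ | ⟨heq, -⟩
    · rw [hv] at hw'
      cases hw'
      exact hx
    · exact absurd (heq.symm.trans hv) hw.ne
  · exact absurd (he.mayFollow hi n) hno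

/-- A crash automaton can generate the crash events of any sequence. -/
theorem IsCrashAutomaton.exists_run {C : Automaton (Act ι M O)} (hC : IsCrashAutomaton C)
    (t : Seq (Act ι M O)) : ∃ ev st, C.StutterRun ev st ∧
      compress (fun n => (ev n).bind Sum.getLeft?) =
        compress fun n => (t.get? n).bind (filt crashActs) := by
  have hover : Over crashActs (proj crashActs t) := by
    intro k a hk
    rw [proj_eq] at hk
    obtain ⟨n, hn, -⟩ := compress_get?_eq_some.1 hk
    exact (bind_filt_eq_some.1 hn).2
  obtain ⟨ex, hfair, htr⟩ := hC.fairTrace _ hover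
  obtain ⟨st, hst⟩ := hfair.exists_stutterRun
  exact ⟨ex.ev.get?, st, hst, htr⟩

theorem exists_match_of_compress_eq {β : Type} {g g' : ℕ → Option β}
    (hg : compress g = compress g') {n : ℕ} {b : β} (hn : g n = some b) :
    ∃ m, g' m = some b ∧ Nat.count (fun n => (g' n).isSome = true) m =
      Nat.count (fun n => (g n).isSome = true) n := by
  have h1 := compress_get?_count hn
  rw [hg] at h1
  exact compress_get?_eq_some.1 h1

/-- The locations whose crash is among the first `m` events. -/
def crashedBy {C : Automaton (Act ι M O)} (ev : ℕ → Option C.Action) (m : ℕ) (i : ι) : Prop :=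
  ∃ m' < m, ev m' = some (Sum.inl (Act.crash i))

/-- A run of the crash automaton can be interleaved with a fair branch in such a way that the
crashes and the failure-detector outputs of the branch form a subsequence of `t`: at time `n`, `K n`
edges of the branch and `Q n` events of the crash automaton have been passed, and `ψ n` is
the position in `t` of the event at time `n`. -/
theorem IsFairBranch.exists_interleaving {C : Automaton (Act ι M O)} (hC : IsCrashAutomaton C)
    {t : Seq (Act ι M O)} (hval : Valid t) (hcomp : G.IsCompatibleWith t)
    (hlive : G.live.Nonempty)
    {e : ℕ → Edge A E hS} (he : IsFairBranch G e) :
    ∃ (ev : ℕ → Option C.Action) (stC : ℕ → C.State) (K Q ψ : ℕ → ℕ),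
      C.StutterRun ev stC ∧ K 0 = 0 ∧ Q 0 = 0 ∧
      (∀ n, (K (n + 1) = K n ∧ Q (n + 1) = Q n + 1) ∨ (K (n + 1) = K n + 1 ∧ Q (n + 1) = Q n)) ∧
      (∀ k, ∃ n, k ≤ K n) ∧ (∀ m, ∃ n, m ≤ Q n) ∧
      (∀ n, K (n + 1) = K n + 1 → (e (K n)).vtag = (branchNode e (K n)).vtag →
        ∀ i, crashedBy ev (Q n) i → ¬ G.FollowsAt (branchNode e (K n)).vtag i) ∧
      (∀ i, (∃ m, ev m = some (Sum.inl (Act.crash i))) ↔ i ∈ faulty t) ∧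
      (∀ n a, K (n + 1) = K n → ev (Q n) = some (Sum.inl a) → t.get? (ψ n) = some a) ∧
      (∀ n w, K (n + 1) = K n + 1 → G.Follows (branchNode e (K n)).vtag w →
        (e (K n)).vtag = some w → t.get? (ψ n) = some w.act) ∧
      ∀ n n', n < n' →
        ((K (n + 1) = K n ∧ ∃ a, ev (Q n) = some (Sum.inl a)) ∨ (K (n + 1) = K n + 1 ∧
          ∃ w, G.Follows (branchNode e (K n)).vtag w ∧ (e (K n)).vtag = some w)) →
        ((K (n' + 1) = K n' ∧ ∃ a, ev (Q n') = some (Sum.inl a)) ∨ (K (n' + 1) = K n' + 1 ∧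
          ∃ w, G.Follows (branchNode e (K n')).vtag w ∧ (e (K n')).vtag = some w)) →
        ψ n < ψ n' := by
  obtain ⟨ev, stC, hrun, htr⟩ := hC.exists_run t
  obtain ⟨pos, hpos, -, hposZ, -⟩ := hcomp.exists_position
  set p : ℕ → Prop := fun n => ((t.get? n).bind (filt crashActs)).isSome = true with hp
  set q : ℕ → Prop := fun n => ((ev n).bind Sum.getLeft?).isSome = true with hq
  have hpi : ∀ n, p n ↔ ∃ i, t.get? n = some (Act.crash i) := fun n => by
    simp only [hp, isSome_bind_filt]
    constructor
    · rintro ⟨_, ⟨i, rfl⟩, hi⟩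
      exact ⟨i, hi⟩
    · rintro ⟨i, hi⟩
      exact ⟨_, ⟨i, rfl⟩, hi⟩
  have hq_of : ∀ m a, ev m = some (Sum.inl a) → q m := fun m a hm => by simp [hq, hm]
  have hev : ∀ m a, ev m = some (Sum.inl a) →
      ∃ n, t.get? n = some a ∧ p n ∧ Nat.count p n = Nat.count q m := fun m a hm => by
    obtain ⟨n, hn, hc⟩ := exists_match_of_compress_eq htr (n := m) (b := a) (by simp [hm])
    exact ⟨n, (bind_filt_eq_some.1 hn).1, by simp [hp, hn], hc⟩
  have hte : ∀ n i, t.get? n = some (Act.crash i) →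
      ∃ m, ev m = some (Sum.inl (Act.crash i)) ∧ Nat.count q m = Nat.count p n := fun n i hn => by
    obtain ⟨m, hm, hc⟩ := exists_match_of_compress_eq htr.symm (n := n) (b := Act.crash i)
      (bind_filt_eq_some.2 ⟨hn, i, rfl⟩)
    refine ⟨m, ?_, hc⟩
    obtain ⟨x, hx, hx'⟩ := Option.bind_eq_some_iff.1 hm
    rw [hx, Sum.getLeft?_eq_some_iff.1 hx']
  -- The successor of the position, so that "before `posO`" includes the vertex itself and the null
  -- tag gets `0`.
  let posO : Option (Vertex ι O) → ℕ := fun v => v.elim 0 fun w => pos w + 1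
  have hfol : ∀ v w, G.Follows v w → posO v ≤ pos w := by
    rintro (_ | u) w hw
    · exact Nat.zero_le _
    · exact hposZ u w hw
  have hfolV : ∀ v w, G.Follows v w → w ∈ G.V := by
    rintro (_ | u) w hw
    · exact hw
    · exact (G.edge_mem u w hw).2
  have hPmono : Monotone fun k => posO (e k).vtag := by
    refine monotone_nat_of_le_succ fun k => ?_
    rcases (he.isEdgeOf (k + 1)).vtag_cases with h | ⟨w, hw, hv⟩
    · rw [h]; rfl
    · rw [hv]
      exact (hfol _ _ hw).trans (Nat.le_succ _)
  -- Each new output at a live location moves the vertex tag strictly forward in `t`.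
  have hPunb : ∀ m, ∃ k, m ≤ posO (e k).vtag := by
    intro m
    induction m with
    | zero => exact ⟨0, Nat.zero_le _⟩
    | succ m ih =>
      obtain ⟨k, hk⟩ := ih
      obtain ⟨i, hi⟩ := hlive
      obtain ⟨n, hn, w, -, hw, hv, -⟩ := he.exists_output hi (k + 1)
      obtain ⟨n, rfl⟩ := Nat.exists_eq_add_of_le' (show 1 ≤ n by omega)
      refine ⟨n + 1, ?_⟩
      rw [hv]
      have h1 : posO (e n).vtag ≤ pos w := hfol _ _ hw
      have h2 : posO (e k).vtag ≤ posO (e n).vtag := hPmono (by omega)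
      show m + 1 ≤ pos w + 1
      omega
  obtain ⟨b, hbmono, hbunb, hb⟩ := exists_matching_counts (p := p) (q := q)
    (fun n hn => by
      obtain ⟨i, hi⟩ := (hpi n).1 hn
      obtain ⟨m, hm, hc⟩ := hte n i hi
      exact ⟨m, hq_of m _ hm, hc⟩)
    (fun m hm => by
      obtain ⟨a, ha⟩ := Option.isSome_iff_exists.1 hm
      obtain ⟨x, hx, hx'⟩ := Option.bind_eq_some_iff.1 ha
      rw [Sum.getLeft?_eq_some_iff.1 hx'] at hx
      obtain ⟨n, -, hn, hc⟩ := hev m a hx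
      exact ⟨n, hn, hc⟩) hPmono hPunb
  obtain ⟨K, Q, hK0, hQ0, hstep, hKunb, hQunb⟩ := exists_schedule hbmono hbunb
  have hKmono : Monotone K := monotone_nat_of_le_succ fun n => by rcases hstep n with h | h <;> omega
  have hQmono : Monotone Q := monotone_nat_of_le_succ fun n => by rcases hstep n with h | h <;> omega
  -- By the choice of `b`, external events of `C` with index below `b k` are exactly the crashes of
  -- `t` before `posO (e k).vtag`. This is one direction, `hafter` the other.
  have hbefore : ∀ m k n, p n → Nat.count p n = Nat.count q m → q m → m < b k →
      n < posO (e k).vtag := by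
    intro m k n hn hc hqm hm
    rw [← count_lt_count_iff (p := p) hn, ← hb k, hc]
    exact Nat.count_strict_mono hqm hm
  have hafter : ∀ m k n, p n → Nat.count p n = Nat.count q m → b k ≤ m →
      posO (e k).vtag ≤ n := by
    intro m k n hn hc hm
    by_contra hcon
    have h1 := (count_lt_count_iff (p := p) hn).2 (not_le.1 hcon)
    rw [← hb k, hc] at h1
    exact absurd (Nat.count_monotone q hm) (not_le.2 h1)
  classical
  -- A crash event is sent to the crash of `t` with the same rank, and an output to the position of
  -- its vertex, which is `posO - 1`.
  refine ⟨ev, stC, K, Q, fun n => if K (n + 1) = K n then Nat.nth p (Nat.count q (Q n)) else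
    posO (e (K n)).vtag - 1, hrun, hK0, hQ0, fun n => (hstep n).imp_right fun h => ⟨h.1, h.2.1⟩,
    hKunb, hQunb, ?_, ?_, ?_, ?_, ?_⟩
  -- A vertex at `i` that may follow the current tag would be an output of `t` at `i` after
  -- `crash_i`, against validity.
  · rintro n hn hv i ⟨m, hm, hmi⟩ ⟨w, hw, rfl⟩
    have hQb : Q n = b (K n) := by
      rcases hstep n with h | h
      · omega
      · exact h.2.2
    obtain ⟨j, hj, hpj, hc⟩ := hev m _ hmi
    have h1 := hbefore m (K n) j hpj hc (hq_of m _ hmi) (hQb ▸ hm)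
    rw [hv] at h1
    exact hval.1 w.loc j (pos w) (lt_of_lt_of_le h1 (hfol _ _ hw)) hj w.out
      (hpos w (hfolV _ _ hw))
  · intro i
    constructor
    · rintro ⟨m, hm⟩
      obtain ⟨n, hn, -⟩ := hev m _ hm
      exact ⟨n, hn⟩
    · rintro ⟨n, hn⟩
      obtain ⟨m, hm, -⟩ := hte n i hn
      exact ⟨m, hm⟩
  · intro n a hn ha
    obtain ⟨j, hj, hpj, hc⟩ := hev _ _ ha
    simp only [hn, if_true]
    rw [← hc, Nat.nth_count hpj, hj]
  · intro n w hn hw hv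
    simp only [hn, Nat.succ_ne_self, if_false, hv]
    exact hpos w (hfolV _ _ hw)
  · rintro n n' hlt hr hr'
    have hQle := hQmono (Nat.succ_le_of_lt hlt)
    have hKle := hKmono (Nat.succ_le_of_lt hlt)
    simp only [Nat.succ_eq_add_one] at hQle hKle
    rcases hr with ⟨hn, a, ha⟩ | ⟨hn, w, hw, hv⟩
    · obtain ⟨j, hj, hpj, hc⟩ := hev _ _ ha
      have hQn : Q (n + 1) = Q n + 1 := by rcases hstep n with h | h <;> omega
      rcases hr' with ⟨hn', a', ha'⟩ | ⟨hn', w', hw', hv'⟩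
      · obtain ⟨j', hj', hpj', hc'⟩ := hev _ _ ha'
        simp only [hn, hn', if_true]
        rw [← hc, ← hc', Nat.nth_count hpj, Nat.nth_count hpj',
          ← count_lt_count_iff (p := p) hpj, hc, hc']
        exact Nat.count_strict_mono (hq_of _ _ ha) (by omega)
      · have hQb : Q n' = b (K n') := by
          rcases hstep n' with h | h
          · omega
          · exact h.2.2
        simp only [hn, hn', if_true, Nat.succ_ne_self, if_false, hv']
        rw [← hc, Nat.nth_count hpj]
        have h1 := hbefore _ (K n') j hpj hc (hq_of _ _ ha) (by omega)
        rw [hv'] at h1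
        -- `hbefore` gives only `j ≤ pos w'`; equality fails since a crash is not an output.
        have h2 : j ≠ pos w' := by
          rintro rfl
          obtain ⟨i, hi⟩ := (hpi _).1 hpj
          rw [hpos w' (hfolV _ _ hw')] at hi
          cases hi
        show j < pos w'
        exact lt_of_le_of_ne (Nat.lt_succ_iff.1 h1) h2
    · rcases hr' with ⟨hn', a', ha'⟩ | ⟨hn', w', hw', hv'⟩
      · obtain ⟨j', hj', hpj', hc'⟩ := hev _ _ ha'
        have hQb : Q n = b (K n) := by
          rcases hstep n with h | h
          · omega
          · exact h.2.2
        simp only [hn, hn', if_true, Nat.succ_ne_self, if_false, hv]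
        rw [← hc', Nat.nth_count hpj']
        have hQ1 : Q (n + 1) = Q n := by rcases hstep n with h | h <;> omega
        have h1 := hafter _ (K n) j' hpj' hc' (by omega)
        rw [hv] at h1
        exact h1
      · simp only [hn, hn', Nat.succ_ne_self, if_false, hv, hv']
        obtain ⟨d, hd⟩ : ∃ d, K n' = d + 1 := ⟨K n' - 1, by omega⟩
        have h1 : posO (e (K n)).vtag ≤ posO (e d).vtag := hPmono (by omega)
        rw [hd] at hw'
        have h2 : posO (e d).vtag ≤ pos w' := hfol _ _ hw'
        rw [hv] at h1
        exact lt_of_lt_of_le (Nat.lt_succ_self _) (h1.trans h2)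

end Branch

end AFD

namespace AFD

/-! ### From a fair branch to a fair run with crashes -/

variable {ι M : Type} {O : ι → Type}

theorem compress_frequently {β : Type} {g : ℕ → Option β} {P : β → Prop}
    (h : ∀ k, ∃ n ≥ k, ∃ b, P b ∧ g n = some b) :
    ∀ k, ∃ n ≥ k, ∃ b, P b ∧ (compress g).get? n = some b := by
  intro k
  have hi : {n | (g n).isSome = true}.Infinite := by
    rw [Set.infinite_iff_exists_gt]
    intro a
    obtain ⟨n, hn, b, -, hb⟩ := h (a + 1)
    exact ⟨n, by simp [hb], hn⟩
  obtain ⟨n, hn, b, hPb, hb⟩ := h (Nat.nth (fun n => (g n).isSome = true) k)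
  refine ⟨_, ?_, b, hPb, compress_get?_count hb⟩
  have h1 := Nat.count_monotone (fun n => (g n).isSome = true) hn
  rwa [Nat.count_nth_of_infinite hi] at h1

/-- Vertices at `i` correspond to the outputs of `t` at `i`, and validity makes these infinitely
many exactly when `crash_i` does not occur. -/
theorem Observation.IsCompatibleWith.live_eq {G : Observation ι O} {t : Seq (Act ι M O)}
    (h : G.IsCompatibleWith t) (hval : Valid t) : G.live = liveLocs t := by
  obtain ⟨pos, hpos, hinj, -, hsurj⟩ := h.exists_position
  ext i
  constructor
  · rintro hi ⟨n, hn⟩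
    have hinf := Set.Infinite.image (f := pos)
      (fun a ha b hb hab => hinj a ha.1 b hb.1 hab) hi
    obtain ⟨_, ⟨w, ⟨hw, rfl⟩, rfl⟩, hlt⟩ := hinf.exists_gt n
    exact hval.1 w.loc n (pos w) hlt hn w.out (hpos w hw)
  · intro hi
    by_contra hfin
    have hfin' : (pos '' {v ∈ G.V | v.loc = i}).Finite := (Set.not_infinite.1 hfin).image pos
    obtain ⟨B, hB⟩ := hfin'.bddAbove
    obtain ⟨n, hn, o, ho⟩ := hval.2 i hi (B + 1)
    obtain ⟨w, hw, rfl⟩ := hsurj n i o ho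
    have hact := hpos w hw
    rw [ho] at hact
    have hloc : w.loc = i := by
      have h1 : (Act.fd i o : Act ι M O).loc = (w.act : Act ι M O).loc :=
        congrArg Act.loc (Option.some.inj hact)
      exact h1.symm
    have := hB ⟨w, ⟨hw, hloc⟩, rfl⟩
    omega

theorem IsEdgeOf.act_ne_crash {A E : ι → Automaton (Act ι M O)} {hS : Compatible (sysFamily A E)}
    {G : Observation ι O} {N : Node A E hS} {e : Edge A E hS} (h : IsEdgeOf G N e)
    (hout : ∀ k i, Act.crash i ∉ (sysFamily A E k).out) (i : ι) :
    e.act ≠ some (Sum.inl (Act.crash i)) := by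
  intro hk
  rcases h.act_cases hk with ⟨κ, T, -, -, hx, -⟩ | ⟨w, -, -, -, hx⟩
  · obtain ⟨y | y, hy, hxy⟩ := mem_compose_task.1 hx
    · cases hxy
      exact hout κ i (Automaton.task_inl_mem_out hy)
    · cases hxy
  · cases hx

section Run

variable {A E : ι → Automaton (Act ι M O)} {C : Automaton (Act ι M O)}

/-- The properties of the components of a system that make crashes compatible with the tree:
failure-detector outputs are inputs of the components, crashes disable the components permanently,
and a component may act exactly as long as no location of its own has come to an end. -/
structure CrashRespecting (G : Observation ι O) (A E : ι → Automaton (Act ι M O)) : Prop where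
  fd_notMem_out : ∀ k i o, Act.fd i o ∉ (sysFamily A E k).out
  mayAct : ∀ k i, Act.crash i ∈ (sysFamily A E k).ext → ∀ v, MayAct G v k → G.FollowsAt v i
  mayAct_of : ∀ k v, (∀ i, Act.crash i ∈ (sysFamily A E k).ext → G.FollowsAt v i) → MayAct G v k
  disabled : ∀ k i, Act.crash i ∈ (sysFamily A E k).ext →
    (sysFamily A E k).PermanentlyDisabledBy (Act.crash i)

/-- Follows the interleaving, with `Matches` as invariant between configuration tags and states of
the full system. Edges with action tag `⊥` become idle instants, and the non-crash external actions
of the run are those of the branch. -/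
theorem IsFairBranch.exists_stutterRun {h : Compatible (fullFamily A E C)}
    (hC : IsCrashAutomaton C) {G : Observation ι O} (hG : CrashRespecting G A E)
    {t : Seq (Act ι M O)} (hval : Valid t) (hcomp : G.IsCompatibleWith t)
    (hlive : G.live.Nonempty) {e : ℕ → Edge A E h.sys} (he : IsFairBranch G e) :
    ∃ g st, (compose (fullFamily A E C) h).StutterRun g st ∧
      (∀ i ∈ G.live, ∀ k, ∃ n ≥ k, ∃ o, g n = some (Sum.inl (Act.fd i o))) ∧
      (∃ φ, IsSubseqVia φ (compress fun n =>
        ((g n).bind Sum.getLeft?).bind (filt (crashActs ∪ fdActs))) t) ∧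
      (∀ i, (∃ n, g n = some (Sum.inl (Act.crash i))) ↔ i ∈ faulty t) ∧
      ∀ a ∉ (crashActs : Set (Act ι M O)),
        (∃ n, g n = some (Sum.inl a)) ↔ ∃ k, (e k).act = some (Sum.inl a) := by
  obtain ⟨ev, stC, K, Q, ψ, hrun, hK0, hQ0, hstep, hKunb, hQunb, hcr, hfaulty, hψC, hψE, hψ⟩ :=
    he.exists_interleaving hC hval hcomp hlive
  have hlf := hcomp.live_eq hval
  have hKle : ∀ n, K n ≤ n := fun n => by
    induction n with
    | zero => omega
    | succ n ih => rcases hstep n with h | h <;> omega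
  have hQle : ∀ n, Q n ≤ n := fun n => by
    induction n with
    | zero => omega
    | succ n ih => rcases hstep n with h | h <;> omega
  have hQmono : Monotone Q := monotone_nat_of_le_succ fun n => by rcases hstep n with h | h <;> omega
  have hKtime : ∀ k, ∃ n, K n = k ∧ K (n + 1) = k + 1 := exists_step_of_unbounded hK0
    (fun n => by rcases hstep n with h | h <;> omega) hKunb
  have hQtime : ∀ k, ∃ n, Q n = k ∧ Q (n + 1) = k + 1 := exists_step_of_unbounded hQ0
    (fun n => by rcases hstep n with h | h <;> omega) hQunb
  classical
  obtain ⟨g, hgC, hgE⟩ : ∃ g : ℕ → Option (compose (fullFamily A E C) h).Action,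
      (∀ n, K (n + 1) = K n → g n = (ev (Q n)).map (liftAct (fullFamily A E C) none)) ∧
      ∀ n, K (n + 1) = K n + 1 → g n = (e (K n)).act.map (liftSys A E C) :=
    ⟨fun n => if K (n + 1) = K n then (ev (Q n)).map (liftAct (fullFamily A E C) none)
      else (e (K n)).act.map (liftSys A E C), fun n hn => if_pos hn,
      fun n hn => if_neg (by omega)⟩
  have hcrash_out := crash_notMem_out h hC
  have hact_notcrash : ∀ k i, (e k).act ≠ some (Sum.inl (Act.crash i)) := fun k i =>
    (he.isEdgeOf k).act_ne_crash hcrash_out i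
  -- The states.
  obtain ⟨st, hst⟩ := exists_seq_of_step (σ := (compose (fullFamily A E C) h).State)
    (P := fun n s => Matches (branchNode e (K n)).cfg (stC (Q n)) (crashedBy ev (Q n)) s ∧
      (n = 0 → s ∈ (compose (fullFamily A E C) h).initial))
    (R := fun n s s' => (compose (fullFamily A E C) h).StutterStep s (g n) s')
    (by
      refine ⟨fun | none => stC 0 | some k => (sys A E h.sys).start k, ⟨?_, fun k => ?_⟩, ?_⟩
      · rw [hQ0]
      · rw [hK0, hQ0]
        refine ⟨fun _ => rfl, ?_⟩
        rintro ⟨i, ⟨m, hm, -⟩, -⟩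
        omega
      · rintro - (_ | k)
        · exact hrun.initial_mem
        · exact start_mem (sys A E h.sys) k)
    (by
      rintro n s ⟨hm, -⟩
      rcases hstep n with ⟨hK, hQ⟩ | ⟨hK, hQ⟩
      · obtain ⟨s', hs', hss'⟩ := hm.exists_crash_step (h := h) hC
          (fun k => (he.isNode (K n)).reachable k) (hrun.step (Q n))
        refine ⟨s', ⟨?_, by omega⟩, by rw [hgC n hK]; exact hss'⟩
        rw [hK, hQ]
        convert hs' using 2 with i
        constructor
        · rintro ⟨m, hm, hmi⟩
          rcases Nat.lt_succ_iff_lt_or_eq.1 hm with h1 | rfl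
          · exact Or.inl ⟨m, h1, hmi⟩
          · exact Or.inr hmi
        · rintro (⟨m, hm, hmi⟩ | hmi)
          · exact ⟨m, by omega, hmi⟩
          · exact ⟨_, Nat.lt_succ_self _, hmi⟩
      · rw [hgE n hK, hK, hQ]
        have hedge := he.isEdgeOf (K n)
        rcases hx : (e (K n)).act with _ | x
        · refine ⟨s, ⟨?_, by omega⟩, rfl⟩
          have h2 := (hedge.act_eq_none hx).2
          show Matches (e (K n)).cfg _ _ _
          rw [h2]
          exact hm
        -- A crashed component does not control the action of this edge: its task would need a
        -- vertex at the crashed location that may follow, which `hcr` excludes, and detector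
        -- outputs are nobody's output.
        · have htask : ∀ κ, Crashed (sysFamily A E κ) (crashedBy ev (Q n)) → ∀ T,
              x ∉ (sys A E h.sys).task ⟨κ, T⟩ := by
            rintro κ ⟨i, hi, hκ⟩ T hxT
            rcases hedge.act_cases hx with ⟨κ', T', -, hmay, hxT', hv⟩ | ⟨w, -, -, -, rfl⟩
            · have hTT := (sys A E h.sys).task_unique _ _ _ hxT hxT'
              cases hTT
              exact hcr n hK hv i hi (hG.mayAct κ i hκ _ hmay)
            · obtain ⟨y | y, hy, hxy⟩ := mem_compose_task.1 hxT
              · cases hxy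
                exact hG.fd_notMem_out κ _ _ (Automaton.task_inl_mem_out hy)
              · cases hxy
          obtain ⟨s', hs', hss'⟩ := hm.exists_sys_step hC (hedge.trans hx)
            (fun i hi => hact_notcrash (K n) i (hi ▸ hx))
            (fun κ hκ a ha hout => by
              obtain ⟨T, hT⟩ := ((sysFamily A E κ).task_cover (Sum.inl a)).2 (Or.inl ⟨a, hout, rfl⟩)
              exact htask κ hκ T (mem_compose_task.2 ⟨_, hT, ha⟩))
            (fun κ hκ y hy => by
              obtain ⟨T, hT⟩ := ((sysFamily A E κ).task_cover (Sum.inr y)).2 (Or.inr ⟨y, rfl⟩)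
              exact htask κ hκ T (mem_compose_task.2 ⟨_, hT, hy⟩))
          exact ⟨s', ⟨hs', by omega⟩, hss'⟩)
  have hmatch := fun n => (hst n).1.1
  have hgE' : ∀ k, ∃ n ≥ k, K n = k ∧ K (n + 1) = K n + 1 := fun k => by
    obtain ⟨n, hn, hn'⟩ := hKtime k
    exact ⟨n, hn ▸ hKle n, hn, by omega⟩
  have hgC' : ∀ k, ∃ n ≥ k, Q n = k ∧ K (n + 1) = K n := fun k => by
    obtain ⟨n, hn, hn'⟩ := hQtime k
    exact ⟨n, hn ▸ hQle n, hn, by rcases hstep n with h | h <;> omega⟩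
  have hgcases : ∀ n a, g n = some (Sum.inl a) →
      (K (n + 1) = K n ∧ ev (Q n) = some (Sum.inl a)) ∨
      (K (n + 1) = K n + 1 ∧ (e (K n)).act = some (Sum.inl a)) := by
    intro n a hn
    rcases hstep n with ⟨hK, -⟩ | ⟨hK, -⟩
    · rw [hgC n hK] at hn
      obtain ⟨x | x, hx, hxa⟩ := Option.map_eq_some_iff.1 hn
      · cases hxa
        exact Or.inl ⟨hK, hx⟩
      · cases hxa
    · rw [hgE n hK] at hn
      obtain ⟨x | x, hx, hxa⟩ := Option.map_eq_some_iff.1 hn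
      · cases hxa
        exact Or.inr ⟨hK, hx⟩
      · cases hxa
  have hevcrash : ∀ m a, ev m = some (Sum.inl a) → a ∈ crashActs := by
    intro m a hm
    have h1 := hrun.step m
    rw [hm] at h1
    have h2 : a ∈ C.ext := C.trans_ext _ _ _ h1
    rwa [hC.ext_eq] at h2
  have hfd : ∀ i ∈ G.live, ∀ k, ∃ n ≥ k, ∃ o, g n = some (Sum.inl (Act.fd i o)) := by
    intro i hi k
    obtain ⟨j, hj, w, rfl, -, -, hw⟩ := he.exists_output hi k
    obtain ⟨n, hn, rfl, hK⟩ := hgE' j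
    exact ⟨n, hj.trans hn, w.out, by rw [hgE n hK, hw]; rfl⟩
  refine ⟨g, st, ⟨(hst 0).1.2 rfl, fun n => (hst n).2, ?_⟩, hfd, ?_, ?_, ?_⟩
  · -- Fairness.
    rintro ⟨_ | κ, T⟩
    · rcases hrun.fair T with hT | hT
      · refine Or.inl fun k => ?_
        obtain ⟨m, hm, x, hx, hevm⟩ := hT k
        obtain ⟨n, hn, rfl, hK⟩ := hgC' m
        exact ⟨n, hm.trans hn, _, mem_compose_task.2 ⟨x, hx, rfl⟩, by rw [hgC n hK, hevm]; rfl⟩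
      · refine Or.inr fun k => ?_
        obtain ⟨m, hm, hdis⟩ := hT k
        obtain ⟨n, hn, rfl, hK⟩ := hgC' m
        refine ⟨n, hm.trans hn, fun hen => hdis ?_⟩
        have h1 := compose_taskEnabled_iff.1 hen
        rw [(hmatch n).1] at h1
        exact h1
    -- Either all locations of the component are live, so that it never crashes and runs exactly as
    -- in the tree, or one of them crashes and the component is eventually dead.
    · by_cases hall : ∀ i, Act.crash i ∈ (sysFamily A E κ).ext → i ∈ G.live
      · have hnc : ∀ m, ¬ Crashed (sysFamily A E κ) (crashedBy ev m) := by
          rintro m ⟨i, ⟨m', -, hm'⟩, hi⟩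
          have h1 := hall i hi
          rw [hlf] at h1
          exact h1 ((hfaulty i).1 ⟨m', hm'⟩)
        have hedge : ∀ k, (e k).label = Label.task κ T →
            (∃ x ∈ (sys A E h.sys).task ⟨κ, T⟩, (e k).act = some x) ∨
            ¬ (sysFamily A E κ).TaskEnabled ((branchNode e k).cfg κ) T := by
          intro k hk
          have h1 := (he.isEdgeOf k).2.2.1
          rw [hk] at h1
          rcases h1 with ⟨-, x, hx, -, hxe⟩ | ⟨hn, -⟩
          · exact Or.inl ⟨x, hx, hxe⟩
          · refine Or.inr fun hen => hn ⟨hG.mayAct_of κ _ fun i hi => he.mayFollow (hall i hi) k, ?_⟩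
            exact compose_taskEnabled_iff.2 hen
        -- If the task is disabled only finitely often along the branch, then every sufficiently
        -- late edge with its label performs an action of the task.
        by_cases hdis : ∀ k, ∃ j ≥ k, ¬ (sysFamily A E κ).TaskEnabled ((branchNode e j).cfg κ) T
        · refine Or.inr fun k => ?_
          obtain ⟨j, hj, hdj⟩ := hdis k
          obtain ⟨n, hn, rfl, hK⟩ := hgE' j
          refine ⟨n, hj.trans hn, fun hen => hdj ?_⟩
          have h1 := compose_taskEnabled_iff.1 hen
          rw [((hmatch n).2 κ).1 (hnc _)] at h1
          exact h1
        · push Not at hdis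
          obtain ⟨k₀, hk₀⟩ := hdis
          refine Or.inl fun k => ?_
          obtain ⟨j, hj, hl⟩ := he.fair (Label.task κ T) (max k k₀)
          rcases hedge j hl with ⟨x, hx, hxe⟩ | hn
          · obtain ⟨n, hn, rfl, hK⟩ := hgE' j
            obtain ⟨y, hy, rfl⟩ := mem_compose_task.1 hx
            refine ⟨n, ((le_max_left _ _).trans hj).trans hn, _,
              mem_compose_task.2 ⟨y, hy, rfl⟩, ?_⟩
            rw [hgE n hK, hxe]
            rcases y with y | y <;> rfl
          · exact absurd (hk₀ j ((le_max_right _ _).trans hj)) hn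
      · push Not at hall
        obtain ⟨i, hi, hil⟩ := hall
        rw [hlf, liveLocs, Set.notMem_compl_iff] at hil
        obtain ⟨m, hm⟩ := (hfaulty i).2 hil
        obtain ⟨n₀, hn₀⟩ := hQunb (m + 1)
        refine Or.inr fun k => ⟨max k n₀, le_max_left _ _, fun hen => ?_⟩
        have h1 : Q n₀ ≤ Q (max k n₀) := hQmono (le_max_right _ _)
        exact (((hmatch (max k n₀)).2 κ).2 ⟨i, ⟨m, by omega, hm⟩, hi⟩).not_taskEnabled
          (fun i hi => hG.disabled κ i hi) T (compose_taskEnabled_iff.1 hen)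
  · -- The failure-detector events.
    obtain ⟨i₀, hi₀⟩ := hlive
    have hrel : ∀ n a, ((g n).bind Sum.getLeft?).bind (filt (crashActs ∪ fdActs)) = some a →
        (K (n + 1) = K n ∧ ev (Q n) = some (Sum.inl a)) ∨ (K (n + 1) = K n + 1 ∧
          ∃ w, G.Follows (branchNode e (K n)).vtag w ∧ (e (K n)).vtag = some w ∧ a = w.act) := by
      intro n a hn
      obtain ⟨h1, ha⟩ := bind_filt_eq_some.1 hn
      obtain ⟨x, hx, hxa⟩ := Option.bind_eq_some_iff.1 h1
      rw [Sum.getLeft?_eq_some_iff.1 hxa] at hx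
      refine (hgcases n a hx).imp_right fun ⟨hK, hact⟩ => ⟨hK, ?_⟩
      rcases (he.isEdgeOf (K n)).act_cases hact with ⟨κ, T, -, -, hx, -⟩ | ⟨w, -, hw, hv, hx⟩
      · obtain ⟨y | y, hy, hxy⟩ := mem_compose_task.1 hx
        · cases hxy
          have hout := Automaton.task_inl_mem_out hy
          rcases ha with ⟨i, rfl⟩ | ⟨i, o, rfl⟩
          · exact absurd hout (hcrash_out κ i)
          · exact absurd hout (hG.fd_notMem_out κ i o)
        · cases hxy
      · exact ⟨w, hw, hv, Sum.inl.inj hx⟩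
    refine isSubseqVia_compress (ψ := ψ) (fun k => ?_) ?_ ?_
    · obtain ⟨n, hn, o, ho⟩ := hfd i₀ hi₀ k
      refine ⟨n, hn, ?_⟩
      rw [isSome_bind_filt]
      exact ⟨Act.fd i₀ o, Or.inr ⟨_, _, rfl⟩, by simp [ho]⟩
    · intro n a hn
      rcases hrel n a hn with ⟨hK, ha⟩ | ⟨hK, w, hw, hv, rfl⟩
      · exact hψC n a hK ha
      · exact hψE n w hK hw hv
    · have hrel' : ∀ n, (((g n).bind Sum.getLeft?).bind
          (filt (crashActs ∪ fdActs))).isSome = true →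
          ((K (n + 1) = K n ∧ ∃ a, ev (Q n) = some (Sum.inl a)) ∨ (K (n + 1) = K n + 1 ∧
            ∃ w, G.Follows (branchNode e (K n)).vtag w ∧ (e (K n)).vtag = some w)) := by
        intro n hn
        obtain ⟨a, ha⟩ := Option.isSome_iff_exists.1 hn
        exact (hrel n a ha).imp (fun h => ⟨h.1, a, h.2⟩) fun ⟨h, w, hw, hv, _⟩ => ⟨h, w, hw, hv⟩
      exact fun n n' hlt hn hn' => hψ n n' hlt (hrel' n hn) (hrel' n' hn')
  · intro i
    rw [← hfaulty i]
    constructor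
    · rintro ⟨n, hn⟩
      rcases hgcases n _ hn with ⟨-, h1⟩ | ⟨-, h1⟩
      · exact ⟨_, h1⟩
      · exact absurd h1 (hact_notcrash _ i)
    · rintro ⟨m, hm⟩
      obtain ⟨n, -, rfl, hK⟩ := hgC' m
      exact ⟨n, by rw [hgC n hK, hm]; rfl⟩
  · intro a ha
    constructor
    · rintro ⟨n, hn⟩
      rcases hgcases n _ hn with ⟨-, h1⟩ | ⟨-, h1⟩
      · exact absurd (hevcrash _ _ h1) ha
      · exact ⟨_, h1⟩
    · rintro ⟨k, hk⟩
      obtain ⟨n, -, rfl, hK⟩ := hgE' k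
      exact ⟨n, by rw [hgE n hK, hk]; rfl⟩

end Run

end AFD

namespace AFD

variable {ι M : Type} {O : ι → Type}

/-! ### The consensus environment -/

theorem EnvStep.of_true {i : ι} {x : Act ι M O ⊕ Empty} {s' : Bool} (h : EnvStep i true x s') :
    s' = true := by
  cases h <;> rfl

theorem EnvStep.to_true {i : ι} {x : Act ι M O ⊕ Empty} {s : Bool} (h : EnvStep i s x true) :
    s = true ∨ x = Sum.inl (Act.crash i) ∨ ∃ v, x = Sum.inl (Act.propose v i) := by
  cases h with
  | crash b => exact Or.inr (Or.inl rfl)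
  | decide b v => exact Or.inl rfl
  | propose v => exact Or.inr (Or.inr ⟨v, rfl⟩)

theorem EnvStep.of_crash {i : ι} {s s' : Bool}
    (h : EnvStep i s (Sum.inl (Act.crash i) : Act ι M O ⊕ Empty) s') : s' = true := by
  cases h; rfl

theorem EnvStep.of_propose {i : ι} {v s s' : Bool}
    (h : EnvStep i s (Sum.inl (Act.propose v i) : Act ι M O ⊕ Empty) s') :
    s = false ∧ s' = true := by
  cases h; exact ⟨rfl, rfl⟩

theorem crash_mem_consensusEnv_ext {i j : ι} :
    Act.crash j ∈ (consensusEnv i : Automaton (Act ι M O)).ext ↔ j = i := by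
  constructor
  · rintro ((h | ⟨v, h⟩) | ⟨v, h⟩)
    · cases h; rfl
    · cases h
    · cases h
  · rintro rfl
    exact Or.inl (Or.inl rfl)

theorem propose_mem_consensusEnv_ext (i : ι) (v : Bool) :
    Act.propose v i ∈ (consensusEnv i : Automaton (Act ι M O)).ext := Or.inr ⟨v, rfl⟩

/-- A crash sets `stop`, which is never reset, and proposals require it to be unset. -/
theorem consensusEnv_permanentlyDisabledBy (i : ι) :
    (consensusEnv i : Automaton (Act ι M O)).PermanentlyDisabledBy (Act.crash i) := by
  intro s s' s'' _ hs hss x hx hen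
  have h1 : s' = true := EnvStep.of_crash hs
  have h2 : s'' = true := by
    clear hen
    induction hss with
    | refl => exact h1
    | tail _ hstep ih =>
      obtain ⟨y, hy⟩ := hstep
      rw [ih] at hy
      exact EnvStep.of_true hy
  obtain ⟨s₃, hs₃⟩ := hen
  rcases hx with ⟨a, ⟨v, rfl⟩, rfl⟩ | ⟨y, -⟩
  · have h3 := (EnvStep.of_propose hs₃).1
    rw [h2] at h3
    cases h3
  · exact y.elim

theorem consensusEnv_taskEnabled {i : ι} {s v : Bool} (h : s = false) :
    (consensusEnv i : Automaton (Act ι M O)).TaskEnabled s v := by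
  subst h
  exact ⟨_, rfl, true, EnvStep.propose v⟩

theorem LocalStep.cases {α κ : Type} {F : κ → Automaton α} {k : κ} {x : α ⊕ Σ k, (F k).Int}
    {s s' : (F k).State} (h : LocalStep F k x s s') :
    s' = s ∨ ∃ y, (F k).trans s y s' ∧ ∀ a, y = Sum.inl a → x = Sum.inl a := by
  rcases x with a | ⟨k', y⟩
  · by_cases ha : a ∈ (F k).ext
    · exact Or.inr ⟨_, h.1 ha, fun b hb => by cases hb; rfl⟩
    · exact Or.inl (h.2 ha)
  · by_cases hk : k' = k
    · exact Or.inr ⟨_, h.1 hk, fun b hb => by cases hb⟩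
    · exact Or.inl (h.2 hk)

section Env

variable {A : ι → Automaton (Act ι M O)} {C : Automaton (Act ι M O)}

theorem env_true_of_sys_step {hS : Compatible (sysFamily A consensusEnv)}
    {c c' : (sys A consensusEnv hS).State} {x : (sys A consensusEnv hS).Action}
    (h : (sys A consensusEnv hS).trans c x c') {i : ι} (hi : c (.env i) = true) :
    c' (.env i) = true := by
  rcases ((compose_trans_iff.1 h).2 (.env i)).cases with h1 | ⟨y, hy, -⟩
  · rw [h1, hi]
  · have hy' : EnvStep i (c (.env i)) y (c' (.env i)) := hy
    rw [hi] at hy'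
    exact hy'.of_true

theorem env_true_cases_of_sys_step {hS : Compatible (sysFamily A consensusEnv)}
    {c c' : (sys A consensusEnv hS).State} {x : (sys A consensusEnv hS).Action}
    (h : (sys A consensusEnv hS).trans c x c') {i : ι} (hi : c' (.env i) = true) :
    c (.env i) = true ∨ x = Sum.inl (Act.crash i) ∨ ∃ v, x = Sum.inl (Act.propose v i) := by
  rcases ((compose_trans_iff.1 h).2 (.env i)).cases with h1 | ⟨y, hy, hya⟩
  · exact Or.inl (h1.symm.trans hi)
  · have hy' : EnvStep i (c (.env i)) y (c' (.env i)) := hy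
    rw [hi] at hy'
    rcases hy'.to_true with h1 | h1 | ⟨v, h1⟩
    · exact Or.inl h1
    · exact Or.inr (Or.inl (hya _ h1))
    · exact Or.inr (Or.inr ⟨v, hya _ h1⟩)

theorem env_of_propose_step {hS : Compatible (sysFamily A consensusEnv)}
    {c c' : (sys A consensusEnv hS).State} {i : ι} {v : Bool}
    (h : (sys A consensusEnv hS).trans c (Sum.inl (Act.propose v i)) c') :
    c (.env i) = false ∧ c' (.env i) = true :=
  EnvStep.of_propose (((compose_trans_iff.1 h).2 (.env i)).1 (propose_mem_consensusEnv_ext i v))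

/-- `stop` is set only by a crash or a proposal, and the tree contains no crash. -/
theorem IsNode.exists_propose {hS : Compatible (sysFamily A consensusEnv)} {G : Observation ι O}
    (hout : ∀ k i, Act.crash i ∉ (sysFamily A consensusEnv k).out)
    {N : Node A consensusEnv hS} (hN : IsNode G N) {i : ι} (hi : N.cfg (.env i) = true) :
    ∃ e ∈ N, ∃ v, e.act = some (Sum.inl (Act.propose v i)) := by
  induction hN with
  | root =>
    have h1 : (sys A consensusEnv hS).start (.env i) = false :=
      start_mem (sys A consensusEnv hS) (.env i)
    have h2 : (sys A consensusEnv hS).start (.env i) = true := hi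
    rw [h1] at h2
    cases h2
  | child N e hN he ih =>
    have hi' : e.cfg (.env i) = true := hi
    rcases hx : e.act with _ | x
    · rw [(he.act_eq_none hx).2] at hi'
      obtain ⟨e', he', hv⟩ := ih hi'
      exact ⟨e', List.mem_cons_of_mem _ he', hv⟩
    · rcases env_true_cases_of_sys_step (he.trans hx) hi' with h1 | rfl | ⟨v, rfl⟩
      · obtain ⟨e', he', hv⟩ := ih h1
        exact ⟨e', List.mem_cons_of_mem _ he', hv⟩
      · exact absurd hx (he.act_ne_crash hout i)
      · exact ⟨e, List.mem_cons_self, v, hx⟩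

theorem Automaton.StutterRun.env_after {h : Compatible (fullFamily A consensusEnv C)} {g st}
    (hrun : (compose (fullFamily A consensusEnv C) h).StutterRun g st) {i : ι} {m : ℕ}
    (hm : g m = some (Sum.inl (Act.crash i)) ∨ ∃ v, g m = some (Sum.inl (Act.propose v i))) :
    ∀ n, m < n → st n (some (.env i)) = true := by
  have hlocal : ∀ n x, g n = some x → LocalStep (fullFamily A consensusEnv C) (some (.env i)) x
      (st n (some (.env i))) (st (n + 1) (some (.env i))) := fun n x hx => by
    have h1 := hrun.step n
    rw [hx] at h1
    exact (compose_trans_iff.1 h1).2 _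
  intro n hn
  induction n, Nat.succ_le_of_lt hn using Nat.le_induction with
  | base =>
    rcases hm with hm | ⟨v, hm⟩
    · exact EnvStep.of_crash ((hlocal m _ hm).1 (crash_mem_consensusEnv_ext.2 rfl))
    · exact (EnvStep.of_propose ((hlocal m _ hm).1 (propose_mem_consensusEnv_ext i v))).2
  | succ n hmn ih =>
    have ih' := ih hmn
    rcases hx : g n with _ | x
    · have h1 := hrun.step n
      rw [hx] at h1
      rw [show st (n + 1) = st n from h1, ih']
    · rcases (hlocal n x hx).cases with h1 | ⟨y, hy, -⟩
      · rw [h1, ih']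
      · have hy' : EnvStep i (st n (some (.env i))) y (st (n + 1) (some (.env i))) := hy
        rw [ih'] at hy'
        exact hy'.of_true

theorem Automaton.StutterRun.not_propose_after {h : Compatible (fullFamily A consensusEnv C)} {g st}
    (hrun : (compose (fullFamily A consensusEnv C) h).StutterRun g st) {i : ι} {m n : ℕ}
    (hm : g m = some (Sum.inl (Act.crash i)) ∨ ∃ v, g m = some (Sum.inl (Act.propose v i)))
    (hmn : m < n) (v : Bool) : g n ≠ some (Sum.inl (Act.propose v i)) := by
  intro hn
  have h1 := hrun.step n
  rw [hn] at h1
  have h2 := (EnvStep.of_propose (((compose_trans_iff.1 h1).2 (some (.env i))).1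
    (propose_mem_consensusEnv_ext i v))).1
  rw [hrun.env_after hm n hmn] at h2
  cases h2

end Env

/-! ### Fair branches of the tree of an algorithm that solves consensus -/

section Consensus

variable {D : Problem (Act ι M O)} {f : ℕ} {C : Automaton (Act ι M O)}
  {A : ι → Automaton (Act ι M O)}

theorem fd_notMem_sysFamily_out (hD : IsAFD D)
    (hsolves : SolvesUsing A (consensus f) D consensusEnv C) (k : Comp ι) (i : ι) (o : O i) :
    Act.fd i o ∉ (sysFamily A consensusEnv k).out := by
  intro hk
  rcases k with j | ⟨j, j', hj⟩ | j
  · have h1 : Act.fd i o ∈ (A j).out := hk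
    rw [hsolves.out_eq, hD.crash_exclusive] at h1
    rcases h1.1 with (⟨_, -, m, hm⟩ | ⟨⟨v, l, hv⟩, -⟩) | ⟨⟨l, hl⟩, -⟩
    · cases hm
    · cases hv
    · cases hl
  · obtain ⟨m, hm⟩ := hk
    cases hm
  · obtain ⟨v, hv⟩ := hk
    cases hv

/-- Processes and environment parts have exactly the crash of their own location. Channels have
none, matching the absence of a condition in `MayAct`. -/
theorem crashRespecting (hD : IsAFD D) (hA : ∀ i, IsProcAutomaton i (A i))
    (hsolves : SolvesUsing A (consensus f) D consensusEnv C) (G : Observation ι O) :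
    CrashRespecting G A consensusEnv where
  fd_notMem_out := fd_notMem_sysFamily_out hD hsolves
  mayAct := by
    rintro (j | ⟨j, j', hj⟩ | j) i hi v hv
    · have : i = j := (hA j).loc_eq _ hi
      exact this ▸ hv
    · rcases hi with ⟨m, hm⟩ | ⟨m, hm⟩ <;> cases hm
    · have : i = j := crash_mem_consensusEnv_ext.1 hi
      exact this ▸ hv
  mayAct_of := by
    rintro (j | ⟨j, j', hj⟩ | j) v h
    · exact h j (Or.inl (hA j).crash_mem)
    · trivial
    · exact h j (crash_mem_consensusEnv_ext.2 rfl)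
  disabled := by
    rintro (j | ⟨j, j', hj⟩ | j) i hi
    · have : i = j := (hA j).loc_eq _ hi
      exact this ▸ (hA j).crash_disables
    · rcases hi with ⟨m, hm⟩ | ⟨m, hm⟩ <;> cases hm
    · have : i = j := crash_mem_consensusEnv_ext.1 hi
      exact this ▸ consensusEnv_permanentlyDisabledBy j

theorem live_nonempty [Fintype ι] {G : Observation ι O} (hf : f < Fintype.card ι)
    (hlive : Fintype.card ι - f ≤ G.live.ncard) : G.live.Nonempty :=
  Set.nonempty_of_ncard_ne_zero (by omega)

theorem mem_branchNode {A E : ι → Automaton (Act ι M O)} {hS : Compatible (sysFamily A E)}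
    {e : ℕ → Edge A E hS} {k : ℕ} {x : Edge A E hS} :
    x ∈ branchNode e k ↔ ∃ j < k, x = e j := by
  induction k with
  | zero => simp [branchNode]
  | succ k ih =>
    rw [branchNode, List.mem_cons, ih]
    constructor
    · rintro (rfl | ⟨j, hj, rfl⟩)
      · exact ⟨k, Nat.lt_succ_self k, rfl⟩
      · exact ⟨j, by omega, rfl⟩
    · rintro ⟨j, hj, rfl⟩
      rcases Nat.lt_succ_iff_lt_or_eq.1 hj with h | rfl
      · exact Or.inr ⟨j, h, rfl⟩
      · exact Or.inl rfl

/-- On a fair branch some location decides, no two decisions differ, and every decision value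
is proposed. -/
theorem IsFairBranch.consensus [Fintype ι] (hD : IsStrongSamplingAFD D) (hf : f < Fintype.card ι)
    (hC : IsCrashAutomaton C) (hA : ∀ i, IsProcAutomaton i (A i))
    (hsolves : SolvesUsing A (consensus f) D consensusEnv C) {G : Observation ι O}
    (hviable : G.Viable D) (hlive : Fintype.card ι - f ≤ G.live.ncard)
    {e : ℕ → Edge A consensusEnv hsolves.compatible.sys} (he : IsFairBranch G e) :
    (∀ v w i j, (∃ k, (e k).act = some (Sum.inl (Act.decide v i))) →
      (∃ k, (e k).act = some (Sum.inl (Act.decide w j))) → v = w) ∧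
    (∀ v i, (∃ k, (e k).act = some (Sum.inl (Act.decide v i))) →
      ∃ j k, (e k).act = some (Sum.inl (Act.propose v j))) ∧
    ∃ v i k, (e k).act = some (Sum.inl (Act.decide v i)) := by
  obtain ⟨t, ht, hcomp⟩ := hviable
  have hval := hD.validity t ht
  have hne := live_nonempty hf hlive
  have hlf := hcomp.live_eq hval
  have hG := crashRespecting hD.toIsAFD hA hsolves G
  obtain ⟨g, st, hrun, hfd, ⟨φ, hφ⟩, hfaulty, hact⟩ := he.exists_stutterRun hC hG hval hcomp hne
  obtain ⟨i₀, hi₀⟩ := hne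
  have hft := hrun.fairTrace fun k => by
    obtain ⟨n, hn, o, ho⟩ := hfd i₀ hi₀ k
    exact ⟨n, hn, by simp [ho]⟩
  have hocc : ∀ (B : Set (Act ι M O)) a n, ((g n).bind Sum.getLeft?).bind (filt B) = some a ↔
      g n = some (Sum.inl a) ∧ a ∈ B := by
    intro B a n
    rw [bind_filt_eq_some]
    refine and_congr_left fun _ => ⟨fun h => ?_, fun h => by simp [h]⟩
    obtain ⟨x, hx, hxa⟩ := Option.bind_eq_some_iff.1 h
    rw [hx, Sum.getLeft?_eq_some_iff.1 hxa]
  have hDT : proj (D.I ∪ D.O)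
      (compress fun n => (g n).bind Sum.getLeft?) ∈ D.T := by
    rw [hD.crash_exclusive, hD.outputs, proj_compress_filt]
    -- Safety in `Valid` is inherited from `t`; the infinitely many outputs at live locations come
    -- from the fairness of the branch.
    refine hD.strong_sampling t ht _ ⟨φ, hφ⟩ ⟨?_, ?_⟩
    · intro i m n hmn hm o hn
      exact hval.1 i _ _ (hφ.1 hmn) (hφ.2 m _ hm) o (hφ.2 n _ hn)
    · intro i hi k
      have hil : i ∈ G.live := by
        rw [hlf]
        intro hit
        obtain ⟨n, hn⟩ := (hfaulty i).2 hit
        exact hi (occurs_compress.2 ⟨n, (hocc _ _ n).2 ⟨hn, Or.inl ⟨i, rfl⟩⟩⟩)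
      have h1 : ∀ k, ∃ n ≥ k, ∃ b, (∃ o, b = Act.fd i o) ∧
          ((g n).bind Sum.getLeft?).bind (filt (crashActs ∪ fdActs)) = some b := fun k => by
        obtain ⟨n, hn, o, ho⟩ := hfd i hil k
        exact ⟨n, hn, _, ⟨o, rfl⟩, (hocc _ _ n).2 ⟨ho, Or.inr ⟨i, o, rfl⟩⟩⟩
      obtain ⟨n, hn, _, ⟨o, rfl⟩, hb⟩ := compress_frequently h1 k
      exact ⟨n, hn, o, hb⟩
  have hPT := hsolves.traces _ hft hDT
  rw [proj_compress_filt] at hPT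
  set B : Set (Act ι M O) := (AFD.consensus f).I ∪ (AFD.consensus f).O with hB
  have hBp : ∀ v i, Act.propose v i ∈ B := fun v i => Or.inl (Or.inl ⟨v, i, rfl⟩)
  have hBc : ∀ i, Act.crash i ∈ B := fun i => Or.inl (Or.inr ⟨i, rfl⟩)
  have hBd : ∀ v i, Act.decide v i ∈ B := fun v i => Or.inr ⟨v, i, rfl⟩
  set t' := compress fun n => ((g n).bind Sum.getLeft?).bind (filt B) with ht'
  have hocc' : ∀ a ∈ B, Occurs a t' ↔ ∃ n, g n = some (Sum.inl a) := fun a ha => by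
    rw [ht', occurs_compress]
    simp only [hocc, ha, and_true]
  have hget : ∀ k a, t'.get? k = some a → ∃ n, g n = some (Sum.inl a) ∧
      Nat.count (fun n => (((g n).bind Sum.getLeft?).bind (filt B)).isSome = true) n = k :=
    fun k a hk => by
      obtain ⟨n, hn, hc⟩ := compress_get?_eq_some.1 hk
      exact ⟨n, ((hocc _ _ n).1 hn).1, hc⟩
  have hfaulty' : faulty t' = faulty t := by
    ext i
    rw [← hfaulty i]
    exact hocc' _ (hBc i)
  have hpropose : ∀ i ∈ G.live, ∃ v k, (e k).act = some (Sum.inl (Act.propose v i)) := by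
    intro i hi
    -- Either value would do: the edge proposes `true`, or `stop` is already set because an earlier
    -- edge made a proposal.
    obtain ⟨k, -, hk⟩ := he.fair (Label.task (.env i) true) 0
    have h1 := (he.isEdgeOf k).2.2.1
    rw [hk] at h1
    rcases h1 with ⟨-, x, hx, -, hxe⟩ | ⟨hn, -⟩
    · obtain ⟨y, hy, rfl⟩ := mem_compose_task.1 hx
      have hy' : y = Sum.inl (Act.propose true i) := hy
      rw [hy'] at hxe
      exact ⟨true, k, hxe⟩
    · have htrue : (branchNode e k).cfg (.env i) = true := by
        by_contra hfalse
        exact hn ⟨he.mayFollow hi k, compose_taskEnabled_iff.2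
          (consensusEnv_taskEnabled (Bool.eq_false_of_not_eq_true hfalse))⟩
      obtain ⟨x, hx, v, hv⟩ := (he.isNode k).exists_propose
        (crash_notMem_out hsolves.compatible hC) htrue
      obtain ⟨j, -, rfl⟩ := mem_branchNode.1 hx
      exact ⟨v, j, hv⟩
  have hwf : EnvWellFormed t' := by
    refine ⟨?_, ?_, ?_⟩
    · intro i m n v w hm hn
      obtain ⟨m', hm', rfl⟩ := hget m _ hm
      obtain ⟨n', hn', rfl⟩ := hget n _ hn
      rcases lt_trichotomy m' n' with h | rfl | h
      · exact absurd hn' (hrun.not_propose_after (Or.inr ⟨v, hm'⟩) h w)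
      · rfl
      · exact absurd hm' (hrun.not_propose_after (Or.inr ⟨w, hn'⟩) h v)
    · intro i m n v hmn hm hn
      obtain ⟨m', hm', rfl⟩ := hget m _ hm
      obtain ⟨n', hn', rfl⟩ := hget n _ hn
      have h : m' < n' := by
        by_contra hcon
        exact absurd (Nat.count_monotone _ (not_lt.1 hcon)) (not_le.2 hmn)
      exact hrun.not_propose_after (Or.inl hm') h v hn'
    · intro i hi
      rw [liveLocs, hfaulty', ← liveLocs, ← hlf] at hi
      obtain ⟨v, hv⟩ := hpropose i hi
      exact ⟨v, (hocc' _ (hBp v i)).2 ((hact _ (by rintro ⟨_, h⟩; cases h)).2 hv)⟩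
  have hlim : CrashLimited f t' := by
    rw [CrashLimited, hfaulty']
    have h1 : faulty t = G.liveᶜ := by rw [hlf, liveLocs, compl_compl]
    -- The faulty locations are the complement of a set with at least `n - f` elements.
    rw [h1, ← Set.Finite.cast_ncard_eq (Set.toFinite _)]
    have h2 := Set.ncard_add_ncard_compl G.live
    rw [Nat.card_eq_fintype_card] at h2
    have h3 : G.liveᶜ.ncard ≤ f := by omega
    exact_mod_cast h3
  obtain ⟨-, hagree, hvalid, -, hterm⟩ := hPT.2 hwf hlim
  have hdec : ∀ v i, Occurs (Act.decide v i) t' ↔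
      ∃ k, (e k).act = some (Sum.inl (Act.decide v i)) := fun v i =>
    (hocc' _ (hBd v i)).trans (hact _ (by rintro ⟨_, h⟩; cases h))
  have hpro : ∀ v i, Occurs (Act.propose v i) t' ↔
      ∃ k, (e k).act = some (Sum.inl (Act.propose v i)) := fun v i =>
    (hocc' _ (hBp v i)).trans (hact _ (by rintro ⟨_, h⟩; cases h))
  refine ⟨?_, ?_, ?_⟩
  · intro v w i j hv hw
    exact hagree i j v w ((hdec v i).2 hv) ((hdec w j).2 hw)
  · intro v i hv
    obtain ⟨j, hj⟩ := hvalid i v ((hdec v i).2 hv)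
    exact ⟨j, (hpro v j).1 hj⟩
  · have hi : i₀ ∈ liveLocs t' := by
      rw [liveLocs, hfaulty', ← liveLocs, ← hlf]
      exact hi₀
    obtain ⟨v, hv⟩ := hterm i₀ hi
    exact ⟨v, i₀, (hdec v i₀).1 hv⟩

end Consensus

end AFD

namespace AFD

variable {ι M : Type} {O : ι → Type}

/-! ### Decision values, equivalent nodes -/

section Nodes

variable {A E : ι → Automaton (Act ι M O)} {hS : Compatible (sysFamily A E)}
  {G : Observation ι O}

theorem hasDecisionValue_iff {N : Node A E hS} {v : Bool} :
    HasDecisionValue N v ↔ ∃ e ∈ N, ∃ i, e.act = some (Sum.inl (Act.decide v i)) := by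
  simp only [HasDecisionValue, exe, List.mem_filterMap, List.mem_reverse, Option.map_eq_some_iff,
    Prod.mk.injEq]
  constructor
  · rintro ⟨i, c, e, he, a, ha, rfl, -⟩
    exact ⟨e, he, i, ha⟩
  · rintro ⟨e, he, i, ha⟩
    exact ⟨i, e.cfg, e, he, _, ha, rfl, rfl⟩

theorem HasDecisionValue.mono {N N' : Node A E hS} {v : Bool} (h : HasDecisionValue N v)
    (hs : N <:+ N') : HasDecisionValue N' v := by
  rw [hasDecisionValue_iff] at h ⊢
  obtain ⟨e, he, hi⟩ := h
  exact ⟨e, hs.subset he, hi⟩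

theorem IsDescendant.trans {N N' N'' : Node A E hS} (h : IsDescendant G N N')
    (h' : IsDescendant G N' N'') : IsDescendant G N N'' := ⟨h'.1, h.2.trans h'.2⟩

theorem IsDescendant.refl {N : Node A E hS} (h : IsNode G N) : IsDescendant G N N :=
  ⟨h, List.suffix_rfl⟩

theorem IsDescendant.cons {N : Node A E hS} {e : Edge A E hS} (h : IsNode G N)
    (he : IsEdgeOf G N e) : IsDescendant G N (e :: N) :=
  ⟨IsNode.child N e h he, List.suffix_cons e N⟩

/-- Nodes with the same tags and the same decision values. -/
structure EquivalentNodes (G : Observation ι O) (N N' : Node A E hS) : Prop where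
  left : IsNode G N
  right : IsNode G N'
  vtag : N.vtag = N'.vtag
  cfg : N.cfg = N'.cfg
  decision : ∀ v, HasDecisionValue N v ↔ HasDecisionValue N' v

theorem EquivalentNodes.symm {N N' : Node A E hS} (h : EquivalentNodes G N N') :
    EquivalentNodes G N' N :=
  ⟨h.right, h.left, h.vtag.symm, h.cfg.symm, fun v => (h.decision v).symm⟩

/-- Outgoing edges depend only on the two tags and on the depth bound, which is void for infinite
`G.V`. -/
theorem EquivalentNodes.isEdgeOf (hV : G.V.Infinite) {N N' : Node A E hS}
    (h : EquivalentNodes G N N') {e : Edge A E hS} (he : IsEdgeOf G N e) : IsEdgeOf G N' e := by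
  obtain ⟨-, h1, h2, h3⟩ := he
  rw [h.vtag] at h1 h2
  rw [h.cfg] at h2 h3
  exact ⟨by rw [hV.encard_eq]; exact ENat.natCast_lt_top _, h1, h2, h3⟩

theorem EquivalentNodes.cons (hV : G.V.Infinite) {N N' : Node A E hS}
    (h : EquivalentNodes G N N') {e : Edge A E hS} (he : IsEdgeOf G N e) :
    EquivalentNodes G (e :: N) (e :: N') where
  left := IsNode.child N e h.left he
  right := IsNode.child N' e h.right (h.isEdgeOf hV he)
  vtag := rfl
  cfg := rfl
  decision v := by
    have h1 := h.decision v
    simp only [hasDecisionValue_iff, List.mem_cons, exists_eq_or_imp] at h1 ⊢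
    rw [h1]

/-- Any path below one node can be grafted below the other, which transfers bivalence and valence.
-/
theorem EquivalentNodes.append (hV : G.V.Infinite) {N N' : Node A E hS}
    (h : EquivalentNodes G N N') (L : Node A E hS) (hL : IsNode G (L ++ N)) :
    EquivalentNodes G (L ++ N) (L ++ N') := by
  induction L with
  | nil => exact h
  | cons e L ih => exact (ih hL.edge.1).cons hV hL.edge.2

theorem EquivalentNodes.exists_descendant (hV : G.V.Infinite) {N N' : Node A E hS}
    (h : EquivalentNodes G N N') {v : Bool}
    (hN : ∃ N₁, IsDescendant G N N₁ ∧ HasDecisionValue N₁ v) :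
    ∃ N₁, IsDescendant G N' N₁ ∧ HasDecisionValue N₁ v := by
  obtain ⟨N₁, ⟨hN₁, L, rfl⟩, hv⟩ := hN
  have h1 := h.append hV L hN₁
  exact ⟨L ++ N', ⟨h1.right, L, rfl⟩, (h1.decision v).1 hv⟩

theorem EquivalentNodes.bivalent (hV : G.V.Infinite) {N N' : Node A E hS}
    (h : EquivalentNodes G N N') (hN : Bivalent G N) : Bivalent G N' :=
  ⟨h.exists_descendant hV hN.1, h.exists_descendant hV hN.2⟩

theorem EquivalentNodes.valent (hV : G.V.Infinite) {N N' : Node A E hS}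
    (h : EquivalentNodes G N N') {v : Bool} (hN : Valent G v N) : Valent G v N' := by
  refine ⟨h.exists_descendant hV hN.1, fun N₁ hN₁ hv => ?_⟩
  obtain ⟨N₂, hN₂, hv₂⟩ := h.symm.exists_descendant hV ⟨N₁, hN₁, hv⟩
  exact hN.2 N₂ hN₂ hv₂

theorem equivalentNodes_of_act_eq_none {N : Node A E hS} {e : Edge A E hS} (hN : IsNode G N)
    (he : IsEdgeOf G N e) (hx : e.act = none) : EquivalentNodes G (e :: N) N where
  left := IsNode.child N e hN he
  right := hN
  vtag := (he.act_eq_none hx).1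
  cfg := (he.act_eq_none hx).2
  decision v := by simp [hasDecisionValue_iff, hx]

/-- Drop the `⊥` edges from the path one by one; each joins equivalent nodes. -/
theorem IsNode.exists_nonBotNode (hV : G.V.Infinite) {N : Node A E hS} (hN : IsNode G N) :
    ∃ N', EquivalentNodes G N N' ∧ NonBotNode N' := by
  induction hN with
  | root => exact ⟨[], ⟨IsNode.root, IsNode.root, rfl, rfl, fun _ => Iff.rfl⟩, by simp [NonBotNode]⟩
  | child N e hN he ih =>
    obtain ⟨N', hN', hbot⟩ := ih
    by_cases hx : e.act = none
    · have h1 := equivalentNodes_of_act_eq_none hN he hx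
      exact ⟨N', ⟨h1.left, hN'.right, h1.vtag.trans hN'.vtag, h1.cfg.trans hN'.cfg,
        fun v => (h1.decision v).trans (hN'.decision v)⟩, hbot⟩
    · refine ⟨e :: N', hN'.cons hV he, ?_⟩
      rintro e' he'
      rcases List.mem_cons.1 he' with rfl | h
      · exact hx
      · exact hbot e' h

theorem exists_nonBotGadget (hV : G.V.Infinite) {Y : GadgetTuple A E hS}
    (hY : IsDecisionGadget G Y) :
    ∃ Y' : GadgetTuple A E hS, IsDecisionGadget G Y' ∧ NonBotGadget Y' := by
  rcases hY with hY | hY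
  · rcases Y with ⟨N, l, El, El'⟩ | _
    · obtain ⟨⟨hN, ⟨h1, h1'⟩, h2, h2'⟩, hb, v, hv, hv'⟩ := hY
      obtain ⟨N', hN', hbot⟩ := hN.exists_nonBotNode hV
      exact ⟨.four N' l El El', Or.inl ⟨⟨hN'.right, ⟨hN'.isEdgeOf hV h1, h1'⟩,
        hN'.isEdgeOf hV h2, h2'⟩, hN'.bivalent hV hb, v, (hN'.cons hV h1).valent hV hv,
        (hN'.cons hV h2).valent hV hv'⟩, hbot⟩
    · exact hY.2.elim
  · rcases Y with _ | ⟨N, l, r, El, Er, Erl⟩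
    · exact hY.2.elim
    · obtain ⟨⟨hN, hlr, ⟨h1, h1'⟩, ⟨h2, h2'⟩, h3, h3'⟩, hb, ⟨v, hv, hv'⟩, hact⟩ := hY
      obtain ⟨N', hN', hbot⟩ := hN.exists_nonBotNode hV
      have hr := hN'.cons hV h2
      exact ⟨.six N' l r El Er Erl, Or.inr ⟨⟨hN'.right, hlr, ⟨hN'.isEdgeOf hV h1, h1'⟩,
        ⟨hN'.isEdgeOf hV h2, h2'⟩, hr.isEdgeOf hV h3, h3'⟩, hN'.bivalent hV hb,
        ⟨v, (hN'.cons hV h1).valent hV hv, (hr.cons hV h3).valent hV hv'⟩, hact⟩, hbot⟩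

/-- If a bivalent node and a label are such that no edge with that label below the node leads to a
bivalent node, then there is a decision gadget below the node. -/
theorem exists_decisionGadget (hV : G.V.Infinite)
    (hedge : ∀ (N : Node A E hS) l, ∃ e, IsEdgeOf G N e ∧ e.label = l)
    (hvalent : ∀ N : Node A E hS, IsNode G N → ¬ Bivalent G N → ∃ v, Valent G v N)
    {N : Node A E hS} (hN : IsNode G N) (hb : Bivalent G N) {l : Label A E}
    (hl : ∀ N', IsDescendant G N N' → ∀ e, IsEdgeOf G N' e → e.label = l →
      ¬ Bivalent G (e :: N')) :
    ∃ Y : GadgetTuple A E hS, IsDecisionGadget G Y := by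
  by_contra hno
  obtain ⟨e₀, he₀, hl₀⟩ := hedge N l
  have hval : ∀ N', IsDescendant G N N' → ∀ e, IsEdgeOf G N' e → e.label = l →
      ∃ v, Valent G v (e :: N') := fun N' hN' e he hel =>
    hvalent _ (IsNode.child N' e hN'.1 he) (hl N' hN' e he hel)
  obtain ⟨v, hv⟩ := hval N (IsDescendant.refl hN) e₀ he₀ hl₀
  have hbool : ∀ {w : Bool}, w ≠ v → w = !v := fun {w} h => by cases v <;> cases w <;> simp_all
  -- In the absence of gadgets, valence `v` of the `l`-edges propagates from `N` along any path
  -- towards a node that decides `!v`.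
  have hclaim : ∀ L : Node A E hS, IsNode G (L ++ N) →
      (∃ N₁, IsDescendant G (L ++ N) N₁ ∧ HasDecisionValue N₁ (!v)) →
      ∀ e, IsEdgeOf G (L ++ N) e → e.label = l → Valent G v (e :: (L ++ N)) := by
    intro L
    induction L with
    | nil =>
      intro _ _ e he hel
      obtain ⟨w, hw⟩ := hval N (IsDescendant.refl hN) e he hel
      by_cases hwv : w = v
      · exact hwv ▸ hw
      · rw [hbool hwv] at hw
        -- Two `l`-edges at `N` of opposite valence are a fork.
        exact absurd ⟨.four N l e₀ e, Or.inl ⟨⟨hN, ⟨he₀, hl₀⟩, he, hel⟩, hb, v, hv, hw⟩⟩ hno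
    | cons r L ih =>
      intro hnode hdec e he hel
      obtain ⟨hnode', hr⟩ := IsNode.edge hnode
      have hdesc : IsDescendant G (L ++ N) (r :: (L ++ N)) := IsDescendant.cons hnode' hr
      have ih' := ih hnode' (by
        obtain ⟨N₁, hN₁, hv₁⟩ := hdec
        exact ⟨N₁, hdesc.trans hN₁, hv₁⟩)
      by_cases hrl : r.label = l
      -- The path itself cannot use label `l`, since it would enter a `v`-valent node above one that
      -- decides `!v`.
      · obtain ⟨N₁, hN₁, hv₁⟩ := hdec
        exact absurd hv₁ ((ih' r hr hrl).2 N₁ hN₁)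
      · obtain ⟨w, hw⟩ := hval _ ⟨hnode, r :: L, rfl⟩ e he hel
        by_cases hwv : w = v
        · exact hwv ▸ hw
        · rw [hbool hwv] at hw
          obtain ⟨e₁, he₁, hl₁⟩ := hedge (L ++ N) l
          have hv₁ := ih' e₁ he₁ hl₁
          have hbiv : Bivalent G (L ++ N) := by
            have h1 : ∃ N₁, IsDescendant G (L ++ N) N₁ ∧ HasDecisionValue N₁ v := by
              obtain ⟨N₁, hN₁, h⟩ := hv₁.1
              exact ⟨N₁, (IsDescendant.cons hnode' he₁).trans hN₁, h⟩
            have h2 : ∃ N₁, IsDescendant G (L ++ N) N₁ ∧ HasDecisionValue N₁ (!v) := by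
              obtain ⟨N₁, hN₁, h⟩ := hdec
              exact ⟨N₁, hdesc.trans hN₁, h⟩
            cases v
            · exact ⟨h1, h2⟩
            · exact ⟨h2, h1⟩
          -- A change of valence across `r` is a hook. Here `r` is not a `⊥` edge: otherwise `e`
          -- would also leave the upper endpoint of `r`, and have both valences.
          refine absurd ⟨.six (L ++ N) l r.label e₁ r e, Or.inr ⟨⟨hnode', Ne.symm hrl, ⟨he₁, hl₁⟩,
            ⟨hr, rfl⟩, he, hel⟩, hbiv, ⟨v, hv₁, hw⟩, fun hx => ?_⟩⟩ hno
          have heq := equivalentNodes_of_act_eq_none hnode' hr hx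
          have h1 := (heq.cons hV he).valent hV hw
          obtain ⟨N₁, hN₁, h⟩ := h1.1
          exact (ih' e (heq.isEdgeOf hV he) hel).2 N₁ hN₁ h
  have hdec : ∃ N₁, IsDescendant G N N₁ ∧ HasDecisionValue N₁ (!v) := by
    cases v
    · exact hb.2
    · exact hb.1
  obtain ⟨N₁, ⟨hN₁, L, rfl⟩, hv₁⟩ := hdec
  obtain ⟨e, he, hel⟩ := hedge (L ++ N) l
  -- An `l`-edge leaving the deciding node is `v`-valent by the claim, yet inherits the decision
  -- `!v`.
  exact (hclaim L hN₁ ⟨_, IsDescendant.refl hN₁, hv₁⟩ e he hel).2 _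
    (IsDescendant.refl (IsNode.child _ _ hN₁ he)) (hv₁.mono (List.suffix_cons _ _))

/-! ### Chains of nodes -/

/-- An ascending sequence of nodes, in which the last edge on the path to the node number `j + 1`
has label `lab j`. -/
structure IsChain (G : Observation ι O) (lab : ℕ → Label A E) (B : ℕ → Node A E hS) : Prop where
  isNode : ∀ j, IsNode G (B j)
  step : ∀ j, ∃ N e, B (j + 1) = e :: N ∧ B j <:+ N ∧ e.label = lab j

theorem IsChain.suffix {lab : ℕ → Label A E} {B : ℕ → Node A E hS} (h : IsChain G lab B) {j j' : ℕ}
    (hj : j ≤ j') : B j <:+ B j' := by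
  induction j', hj using Nat.le_induction with
  | base => exact List.suffix_rfl
  | succ j' _ ih =>
    obtain ⟨N, e, h1, h2, -⟩ := h.step j'
    rw [h1]
    exact (ih.trans h2).trans (List.suffix_cons e N)

theorem IsChain.le_length {lab : ℕ → Label A E} {B : ℕ → Node A E hS} (h : IsChain G lab B)
    (j : ℕ) : j ≤ (B j).length := by
  induction j with
  | zero => exact Nat.zero_le _
  | succ j ih =>
    obtain ⟨N, e, h1, h2, -⟩ := h.step j
    rw [h1, List.length_cons]
    exact Nat.succ_le_succ (ih.trans h2.length_le)

/-- `B k` has depth at least `k`, so its ancestor of depth `k` is a suffix of the list; these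
ancestors are consecutive because the `B k` are nested. -/
theorem IsChain.exists_branch {lab : ℕ → Label A E} (hlab : ∀ l k, ∃ n ≥ k, lab n = l)
    {B : ℕ → Node A E hS} (h : IsChain G lab B) :
    ∃ e, IsFairBranch G e ∧ (∀ j, ∃ k, branchNode e k = B j) ∧ ∀ k, branchNode e k <:+ B k := by
  let N : ℕ → Node A E hS := fun k => (B k).drop ((B k).length - k)
  have hNsuf : ∀ k, N k <:+ B k := fun k => List.drop_suffix _ _
  have hNlen : ∀ k, (N k).length = k := fun k => by
    have := h.le_length k
    simp only [N, List.length_drop]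
    omega
  have hstep : ∀ k, ∃ e, N (k + 1) = e :: N k := fun k => by
    obtain ⟨L, hL⟩ := List.suffix_of_suffix_length_le ((hNsuf k).trans (h.suffix (Nat.le_succ k)))
      (hNsuf (k + 1)) (by rw [hNlen, hNlen]; omega)
    have h1 := congrArg List.length hL
    rw [List.length_append, hNlen, hNlen] at h1
    obtain ⟨e, rfl⟩ := List.length_eq_one_iff.1 (show L.length = 1 by omega)
    exact ⟨e, hL.symm⟩
  choose e he using hstep
  have hbr : ∀ k, branchNode e k = N k := fun k => by
    induction k with
    | zero => exact (List.length_eq_zero_iff.1 (hNlen 0)).symm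
    | succ k ih => rw [branchNode, ih, he]
  have hB : ∀ j, branchNode e (B j).length = B j := fun j => by
    rw [hbr]
    have h1 : N (B j).length <:+ B (max j (B j).length) :=
      (hNsuf _).trans (h.suffix (le_max_right _ _))
    have h2 : B j <:+ B (max j (B j).length) := h.suffix (le_max_left _ _)
    exact (List.suffix_of_suffix_length_le h1 h2 (hNlen _).le).eq_of_length (hNlen _)
  refine ⟨e, ⟨fun k => ?_, fun l k => ?_⟩, fun j => ⟨_, hB j⟩, fun k => ?_⟩
  · rw [hbr]
    exact (h.isNode k).of_suffix (hNsuf k)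
  · obtain ⟨j, hj, rfl⟩ := hlab l k
    obtain ⟨N', e', h1, h2, h3⟩ := h.step j
    refine ⟨N'.length, hj.trans ((h.le_length j).trans h2.length_le), ?_⟩
    have h4 := hB (j + 1)
    rw [h1, List.length_cons, branchNode] at h4
    rw [(List.cons.inj h4).1, h3]
  · rw [hbr]
    exact hNsuf k

theorem IsNode.exists_chain (hedge : ∀ (N : Node A E hS) l, ∃ e, IsEdgeOf G N e ∧ e.label = l)
    (lab : ℕ → Label A E) {N : Node A E hS} (hN : IsNode G N) :
    ∃ B : ℕ → Node A E hS, IsChain G lab B ∧ B 0 = N := by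
  obtain ⟨B, hB⟩ := exists_seq_of_step (σ := Node A E hS)
    (P := fun n N' => IsNode G N' ∧ (n = 0 → N' = N))
    (R := fun n N' N'' => ∃ N e, N'' = e :: N ∧ N' <:+ N ∧ e.label = lab n)
    ⟨N, hN, fun _ => rfl⟩ (by
      rintro n N' ⟨hN', -⟩
      obtain ⟨e, he, hl⟩ := hedge N' (lab n)
      exact ⟨e :: N', ⟨IsNode.child N' e hN' he, by omega⟩, N', e, rfl, List.suffix_rfl, hl⟩)
  exact ⟨B, ⟨fun j => (hB j).1.1, fun j => (hB j).2⟩, (hB 0).1.2 rfl⟩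

end Nodes

end AFD

namespace AFD

variable {ι M : Type} {O : ι → Type}

/-! ### Fair enumeration of labels, existence of edges -/

section Labels

variable {A E : ι → Automaton (Act ι M O)}

theorem countable_comp [Countable ι] : Countable (Comp ι) := by
  let F : Comp ι → ι ⊕ (ι × ι) ⊕ ι
    | .proc i => .inl i
    | .chan i j _ => .inr (.inl (i, j))
    | .env i => .inr (.inr i)
  have hF : Function.Injective F := by
    rintro (i | ⟨i, j, h⟩ | i) (i' | ⟨i', j', h'⟩ | i') hF <;> simp_all [F]
  exact hF.countable

theorem countable_label [Countable ι] (h : ∀ k, Countable (sysFamily A E k).Task) :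
    Countable (Label A E) := by
  have := countable_comp (ι := ι)
  let F : Label A E → (Σ k : Comp ι, (sysFamily A E k).Task) ⊕ ι
    | .task k T => .inl ⟨k, T⟩
    | .FD i => .inr i
  have hF : Function.Injective F := by
    rintro (⟨k, T⟩ | i) (⟨k', T'⟩ | i') hF
    · have h1 := Sum.inl.inj hF
      cases h1
      rfl
    · cases hF
    · cases hF
    · have h1 := Sum.inr.inj hF
      cases h1
      rfl
  exact hF.countable

theorem exists_frequent_enumeration (α : Type) [Countable α] [Nonempty α] :
    ∃ lab : ℕ → α, ∀ l k, ∃ n ≥ k, lab n = l := by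
  obtain ⟨F, hF⟩ := exists_surjective_nat α
  refine ⟨fun n => F n.unpair.1, fun l k => ?_⟩
  obtain ⟨a, rfl⟩ := hF l
  -- Cantor pairing repeats each label at an index beyond any bound `k`.
  exact ⟨Nat.pair a k, Nat.right_le_pair a k, by simp⟩

theorem exists_edge {hS : Compatible (sysFamily A E)} {G : Observation ι O} (hV : G.V.Infinite)
    (hin : ∀ i o, Act.fd i o ∈ (A i).inp)
    (hout : ∀ k i o, Act.fd i o ∉ (sysFamily A E k).out) (N : Node A E hS) (l : Label A E) :
    ∃ e, IsEdgeOf G N e ∧ e.label = l := by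
  have hlen : (N.length : ℕ∞) < G.V.encard := by
    rw [hV.encard_eq]
    exact ENat.natCast_lt_top _
  rcases l with ⟨k, T⟩ | i
  · by_cases h : MayAct G N.vtag k ∧ (sys A E hS).TaskEnabled N.cfg ⟨k, T⟩
    · obtain ⟨h1, x, hx, s', hs'⟩ := h
      exact ⟨⟨.task k T, N.vtag, some x, s'⟩, ⟨hlen, rfl, Or.inl ⟨h1, x, hx, ⟨s', hs'⟩, rfl⟩, hs'⟩,
        rfl⟩
    · exact ⟨⟨.task k T, N.vtag, none, N.cfg⟩, ⟨hlen, rfl, Or.inr ⟨h, rfl⟩, rfl⟩, rfl⟩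
  · by_cases h : G.FollowsAt N.vtag i
    · obtain ⟨w, hw, rfl⟩ := h
      -- A detector output is controlled by no component, so input-enabledness provides the next
      -- configuration.
      have hex : ∀ k, ∃ s', LocalStep (sysFamily A E) k (Sum.inl (Act.fd w.loc w.out)) (N.cfg k) s' :=
        fun k => exists_localStep_input (A := sysFamily A E) (hout k _ _) _
      choose s' hs' using hex
      refine ⟨⟨.FD w.loc, some w, some (Sum.inl w.act), s'⟩, ⟨hlen, Or.inl ⟨w, hw, rfl, rfl⟩,
        Or.inl ⟨w, rfl, hw.ne.symm, rfl⟩, compose_trans_iff.2 ⟨⟨.proc w.loc, ?_⟩, hs'⟩⟩, rfl⟩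
      exact Or.inl (hin _ _)
    · exact ⟨⟨.FD i, N.vtag, none, N.cfg⟩, ⟨hlen, Or.inr ⟨h, rfl⟩, Or.inr ⟨rfl, rfl⟩, rfl⟩, rfl⟩

end Labels

/-! ### Proposals in the tree -/

section Proposals

variable {A : ι → Automaton (Act ι M O)} {hS : Compatible (sysFamily A consensusEnv)}
  {G : Observation ι O}

/-- There is a node at which the given locations have proposed `v`, as far as they may act. -/
theorem exists_node_proposing
    (hedge : ∀ (N : Node A consensusEnv hS) l, ∃ e, IsEdgeOf G N e ∧ e.label = l) (v : Bool)
    (L : List ι) : ∃ N : Node A consensusEnv hS, IsNode G N ∧ N.vtag = none ∧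
      (∀ e ∈ N, ∀ x, e.act = some x → ∃ i, x = Sum.inl (Act.propose v i)) ∧
      ∀ i ∈ L, G.FollowsAt none i → N.cfg (.env i) = true := by
  induction L with
  | nil => exact ⟨[], IsNode.root, rfl, by simp, by simp⟩
  | cons i L ih =>
    obtain ⟨N, hN, hv, hact, hL⟩ := ih
    -- Only task edges are used, so the vertex tag stays null and the location may act exactly when
    -- it has a vertex at all.
    obtain ⟨e, he, hl⟩ := hedge N (.task (.env i) v)
    have htag := he.2.1
    rw [hl] at htag
    have hx : ∀ x, e.act = some x → x = Sum.inl (Act.propose v i) := by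
      intro x hx
      rcases he.act_cases hx with ⟨k, T, hk, -, hxT, -⟩ | ⟨w, hw, -⟩
      · rw [hl] at hk
        cases hk
        obtain ⟨y, hy, rfl⟩ := mem_compose_task.1 hxT
        have hy' : y = Sum.inl (Act.propose v i) := hy
        rw [hy']
        rfl
      · rw [hl] at hw
        cases hw
    refine ⟨e :: N, IsNode.child N e hN he, Eq.trans htag hv, ?_, ?_⟩
    · intro e' he' x hx'
      rcases List.mem_cons.1 he' with rfl | h
      · exact ⟨i, hx x hx'⟩
      · exact hact e' h x hx'
    · intro j hj hfol
      show e.cfg (.env j) = true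
      have hkeep : N.cfg (.env j) = true → e.cfg (.env j) = true := by
        intro h1
        rcases hxe : e.act with _ | x
        · rw [(he.act_eq_none hxe).2]
          exact h1
        · exact env_true_of_sys_step (he.trans hxe) h1
      rcases List.mem_cons.1 hj with rfl | h
      · by_cases h1 : N.cfg (.env j) = true
        · exact hkeep h1
        · have h2 := he.2.2.1
          rw [hl] at h2
          rcases h2 with ⟨-, x, -, -, hxe⟩ | ⟨hn, -⟩
          · have h3 := he.trans hxe
            rw [hx x hxe] at h3
            exact (env_of_propose_step h3).2
          · refine absurd ⟨?_, compose_taskEnabled_iff.2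
              (consensusEnv_taskEnabled (Bool.eq_false_of_not_eq_true h1))⟩ hn
            rw [hv]
            exact hfol
      · exact hkeep (hL j h hfol)

/-- If all the locations that may act have made their proposals at `N`, then no further proposal
occurs below `N`. -/
theorem not_propose_of_all_proposed {N : Node A consensusEnv hS}
    (hN : ∀ i, G.FollowsAt none i → N.cfg (.env i) = true) (hfd : ∀ (w : Vertex ι O) v i,
      (w.act : Act ι M O) ≠ Act.propose v i) (L : Node A consensusEnv hS)
    (hL : IsNode G (L ++ N)) :
    (∀ i, G.FollowsAt none i → Node.cfg (L ++ N) (.env i) = true) ∧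
    ∀ e ∈ L, ∀ v i, e.act ≠ some (Sum.inl (Act.propose v i)) := by
  induction L with
  | nil => exact ⟨hN, by simp⟩
  | cons e L ih =>
    obtain ⟨hnode, he⟩ := IsNode.edge hL
    obtain ⟨h1, h2⟩ := ih hnode
    refine ⟨fun i hi => ?_, ?_⟩
    · show e.cfg (.env i) = true
      rcases hx : e.act with _ | x
      · rw [(he.act_eq_none hx).2]
        exact h1 i hi
      · exact env_true_of_sys_step (he.trans hx) (h1 i hi)
    · intro e' he' v i hx
      rcases List.mem_cons.1 he' with rfl | h
      -- A proposal needs `stop` unset and a location that may act, but at such locations `stop` is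
      -- already set.
      · have h3 := (env_of_propose_step (he.trans hx)).1
        have hfol : G.FollowsAt none i := by
          rcases he.act_cases hx with ⟨k, T, -, hmay, hxT, -⟩ | ⟨w, -, -, -, hw⟩
          · have hxT' : (Sum.inl (Act.propose v i) : (sys A consensusEnv hS).Action) ∈
                (sys A consensusEnv hS).task ⟨.env i, v⟩ :=
              mem_compose_task.2 ⟨Sum.inl (Act.propose v i), rfl, rfl⟩
            have h4 := (sys A consensusEnv hS).task_unique _ _ _ hxT hxT'
            cases h4
            exact Observation.followsAt_none hmay
          · exact absurd (Sum.inl.inj hw).symm (hfd w v i)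
        exact Bool.noConfusion ((h1 i hfol).symm.trans h3)
      · exact h2 e' h v i hx

end Proposals

end AFD

/-! ### The bivalence argument -/

theorem mainTheorem3 {ι M : Type} [Fintype ι] {O : ι → Type}
    (D : AFD.Problem (AFD.Act ι M O)) (hD : AFD.IsStrongSamplingAFD D)
    (f : ℕ) (hf : f < Fintype.card ι)
    (C : AFD.Automaton (AFD.Act ι M O)) (hC : AFD.IsCrashAutomaton C)
    (A : ι → AFD.Automaton (AFD.Act ι M O)) (hA : ∀ i, AFD.IsProcAutomaton i (A i))
    (hsolves : AFD.SolvesUsing A (AFD.consensus f) D AFD.consensusEnv C)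
    (G : AFD.Observation ι O) (hviable : G.Viable D)
    (hlive : Fintype.card ι - f ≤ G.live.ncard) :
    ∃ Y : AFD.GadgetTuple A AFD.consensusEnv hsolves.compatible.sys,
      AFD.IsDecisionGadget G Y ∧ AFD.NonBotGadget Y := by
  open AFD in
  have hV : G.V.Infinite := by
    obtain ⟨i, hi⟩ := live_nonempty hf hlive
    exact Set.Infinite.mono (fun v hv => hv.1) hi
  have hne : Nonempty ι := Fintype.card_pos_iff.1 (by omega)
  have hin : ∀ i o, Act.fd i o ∈ (A i).inp := fun i o => by
    rw [hsolves.inp_eq, hD.outputs]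
    exact Or.inr ⟨⟨i, o, rfl⟩, rfl⟩
  have hedge : ∀ (N : Node A consensusEnv hsolves.compatible.sys) l,
      ∃ e, IsEdgeOf G N e ∧ e.label = l :=
    exists_edge hV hin (fd_notMem_sysFamily_out hD.toIsAFD hsolves)
  have hcount : Countable (Label A consensusEnv) := by
    refine countable_label ?_
    rintro (i | ⟨i, j, h⟩ | i)
    · obtain ⟨T, -, hT⟩ := (hA i).deterministic.2.1
      have : Subsingleton (A i).Task := ⟨fun a b => (hT a trivial).trans (hT b trivial).symm⟩
      exact inferInstanceAs (Countable (A i).Task)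
    · exact inferInstanceAs (Countable Unit)
    · exact inferInstanceAs (Countable Bool)
  have : Nonempty (Label A consensusEnv) := hne.map Label.FD
  obtain ⟨lab, hlab⟩ := exists_frequent_enumeration (Label A consensusEnv)
  -- The consensus properties of fair branches, restated for cofinal sequences of nodes, where
  -- consecutive terms may be far apart.
  have hchain : ∀ B : ℕ → Node A consensusEnv hsolves.compatible.sys, IsChain G lab B →
      (∀ j j' v w, HasDecisionValue (B j) v → HasDecisionValue (B j') w → v = w) ∧
      (∀ j v, HasDecisionValue (B j) v →
        ∃ i j', ∃ e ∈ B j', e.act = some (Sum.inl (Act.propose v i))) ∧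
      ∃ j v, HasDecisionValue (B j) v := by
    intro B hB
    obtain ⟨e, he, hBe, heB⟩ := hB.exists_branch hlab
    obtain ⟨h1, h2, h3⟩ := he.consensus hD hf hC hA hsolves hviable hlive
    have hdec : ∀ j v, HasDecisionValue (B j) v →
        ∃ i k, (e k).act = some (Sum.inl (Act.decide v i)) := by
      intro j v hv
      obtain ⟨x, hx, i, hxi⟩ := hasDecisionValue_iff.1 hv
      obtain ⟨k, hk⟩ := hBe j
      rw [← hk] at hx
      obtain ⟨m, -, rfl⟩ := mem_branchNode.1 hx
      exact ⟨i, m, hxi⟩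
    have hmem : ∀ k, e k ∈ B (k + 1) := fun k =>
      (heB (k + 1)).subset List.mem_cons_self
    refine ⟨fun j j' v w hv hw => ?_, fun j v hv => ?_, ?_⟩
    · obtain ⟨i, hi⟩ := hdec j v hv
      obtain ⟨i', hi'⟩ := hdec j' w hw
      exact h1 v w i i' hi hi'
    · obtain ⟨i, hi⟩ := hdec j v hv
      obtain ⟨i', k, hk⟩ := h2 v i hi
      exact ⟨i', k + 1, e k, hmem k, hk⟩
    · obtain ⟨v, i, k, hk⟩ := h3
      exact ⟨k + 1, v, hasDecisionValue_iff.2 ⟨e k, hmem k, i, hk⟩⟩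
  have hunique : ∀ N : Node A consensusEnv hsolves.compatible.sys, IsNode G N →
      ∀ v w, HasDecisionValue N v → HasDecisionValue N w → v = w := by
    intro N hN v w hv hw
    obtain ⟨B, hB, rfl⟩ := hN.exists_chain hedge lab
    exact (hchain B hB).1 0 0 v w hv hw
  have hdecides : ∀ N : Node A consensusEnv hsolves.compatible.sys, IsNode G N →
      ∃ N' v, IsDescendant G N N' ∧ HasDecisionValue N' v := by
    intro N hN
    obtain ⟨B, hB, rfl⟩ := hN.exists_chain hedge lab
    obtain ⟨j, v, hv⟩ := (hchain B hB).2.2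
    exact ⟨B j, v, ⟨hB.isNode j, hB.suffix (Nat.zero_le j)⟩, hv⟩
  have hvalent : ∀ N : Node A consensusEnv hsolves.compatible.sys, IsNode G N →
      ¬ Bivalent G N → ∃ v, Valent G v N := by
    intro N hN hb
    obtain ⟨N', v, hN', hv⟩ := hdecides N hN
    refine ⟨v, ⟨N', hN', hv⟩, fun N'' hN'' hv' => hb ?_⟩
    cases v
    · exact ⟨⟨N', hN', hv⟩, ⟨N'', hN'', hv'⟩⟩
    · exact ⟨⟨N'', hN'', hv'⟩, ⟨N', hN', hv⟩⟩
  -- Extend a node at which only `v` has been proposed: on the resulting fair branch a decision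
  -- occurs, and its value must be `v`.
  have hroot : ∀ v, ∃ N : Node A consensusEnv hsolves.compatible.sys,
      IsDescendant G [] N ∧ HasDecisionValue N v := by
    intro v
    obtain ⟨N, hN, -, hact, hall⟩ :=
      exists_node_proposing hedge v (Finset.univ : Finset ι).toList
    obtain ⟨B, hB, rfl⟩ := hN.exists_chain hedge lab
    obtain ⟨-, hpro, j, w, hw⟩ := hchain B hB
    obtain ⟨i, j', e, he, hei⟩ := hpro j w hw
    have hj' := hB.isNode j'
    obtain ⟨L, hL⟩ := hB.suffix (Nat.zero_le j')
    rw [← hL] at he hj'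
    have hnew := not_propose_of_all_proposed (fun i hi => hall i (by simp) hi)
      (fun w v i h => by cases h) L hj'
    have hwv : w = v := by
      rcases List.mem_append.1 he with h | h
      · exact absurd hei (hnew.2 e h w i)
      · obtain ⟨i', hi'⟩ := hact e h _ hei
        cases hi'
        rfl
    exact ⟨B j, ⟨hB.isNode j, List.nil_suffix⟩, hwv ▸ hw⟩
  -- Otherwise bivalent nodes can be chosen forever while serving the labels in the order of `lab`.
  have hstuck : ∃ N : Node A consensusEnv hsolves.compatible.sys, IsNode G N ∧ Bivalent G N ∧
      ∃ l, ∀ N', IsDescendant G N N' → ∀ e, IsEdgeOf G N' e → e.label = l →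
        ¬ Bivalent G (e :: N') := by
    by_contra hcon
    push Not at hcon
    obtain ⟨B, hB⟩ := exists_seq_of_step (σ := Node A consensusEnv hsolves.compatible.sys)
      (P := fun _ N => IsNode G N ∧ Bivalent G N)
      (R := fun n N' N'' => ∃ N e, N'' = e :: N ∧ N' <:+ N ∧ e.label = lab n)
      ⟨[], IsNode.root, hroot false, hroot true⟩ (by
        rintro n N ⟨hN, hb⟩
        obtain ⟨N', hN', e, he, hl, hb'⟩ := hcon N hN hb (lab n)
        exact ⟨e :: N', ⟨IsNode.child N' e hN'.1 he, hb'⟩, N', e, rfl, hN'.2, hl⟩)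
    obtain ⟨-, -, j, v, hv⟩ := hchain B ⟨fun j => (hB j).1.1, fun j => (hB j).2⟩
    obtain ⟨⟨N₀, hN₀, h0⟩, N₁, hN₁, h1⟩ := (hB j).1.2
    -- A decision made at a bivalent node persists in its descendants deciding `0` and `1`, each of
    -- which has only one decision value.
    have e0 := hunique N₀ hN₀.1 _ _ h0 (hv.mono hN₀.2)
    have e1 := hunique N₁ hN₁.1 _ _ h1 (hv.mono hN₁.2)
    rw [← e0] at e1
    cases e1
  obtain ⟨N, hN, hb, l, hl⟩ := hstuck
  obtain ⟨Y, hY⟩ := exists_decisionGadget hV hedge hvalent hN hb hl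
  exact exists_nonBotGadget hV hY
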